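/- **Setting.** Let $\Omega\subset\mathbb R^3$ be open and let $\mathcal T$ be a finite conforming tetrahedral triangulation of $\overline\Omega$. Let $0=t_0<t_1<\dots<t_N=T$, $I_n=[t_{n-1},t_n]$ and $Q_n=\Omega\times I_n$. For $m\in\mathbb N$ let $V_h^m$ be the space of continuous functions on $\overline\Omega$ that are polynomials of degree at most $m$ on each $K\in\mathcal T$. Let $k_s,k_q\in\mathbb N$. On each time slab let $\phi_h(\mathbf x,t)=\sum_{i=0}^{k_q}t^i v_i(\mathbf x)$ with $v_i\in V_h^{k_s}$ (the $v_i$ may depend on the slab). Let $\hat\phi_h(\cdot,t)\in V_h^1$ be the nodal interpolant of $\phi_h(\cdot,t)$. Fix $n\in\{1,\dots,N\}$ and put $$\Gamma_{\rm lin}(t)=\{\mathbf x\in\Omega:\hat\phi_h(\mathbf x,t)=0\},\qquad S^n_{\rm lin}=\{(\mathbf x,t)\in Q_n:\hat\phi_h(\mathbf x,t)=0\}.$$ Let $\mathcal T_n^\Gamma$ be the set of $K\in\mathcal T$ such that $K\cap\Gamma_{\rm lin}(t)$ has positive two-dimensional measure for some $t\in I_n$, and let $Q_n^S=\bigcup_{K\in\mathcal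 T_n^\Gamma}K\times I_n$. Given distinct points $\tau_0,\dots,\tau_{k_q}\in I_n$ with Lagrange basis polynomials $\mathcal X_{\tau_m}$, and mesh deformations $\Theta_{\tau_m}\in (V_h^{k_s})^3$, let $$\Theta_{h,s}^n(\mathbf x,t)=\sum_{m=0}^{k_q}\mathcal X_{\tau_m}(t)\,\Theta_{\tau_m}(\mathbf x),\qquad \Theta_h^n(\mathbf x,t)=(\Theta_{h,s}^n(\mathbf x,t),t)\quad\text{on } Q_n^S .$$ Assume that these objects are nondegenerate: $\Theta_h^n$ is injective on $Q_n^S$; for each $K\in\mathcal T_n^\Gamma$ the spatial Jacobian $D\Theta_{h,s}^n$, computed on $K$, is invertible on $K\times I_n$; and for each such $K$ the spatial gradient $\nabla\hat\phi_h$, computed on $K$, does not vanish on $S^n_{\rm lin}\cap (K\times I_n)$. The discrete space-time surface and its time slices are $$S_h^n=Q_n\cap\Theta_h^n(S_{\rm lin}^n\cap Q_n^S),\qquad \Gamma_h^n(t)=\{\mathbf x\in\mathbb R^3:(\mathbf x,t)\in S_h^n\}.$$ Let $d\sigma_h$ and $ds_h$ be the three- and two-dimensional surface measures on $S_h^n$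 and $\Gamma_h^n(t)$ (Hausdorff measures in $\mathbb R^4$ and $\mathbb R^3$ with the Euclidean normalization). The discrete normal velocity is $$V_h=\frac{-\,\partial_t\big(\hat\phi_h\circ(\Theta_h^n)^{-1}\big)}{\big\|\nabla\big(\hat\phi_h\circ(\Theta_h^n)^{-1}\big)\big\|}\qquad\text{a.e. on }S_h^n,$$ where the derivatives are taken elementwise, that is, on the deformed prisms $\Theta_h^n(K\times I_n)$, $K\in\mathcal T_n^\Gamma$. (At a point of several deformed prisms one of them is chosen; almost everywhere on $S_h^n$ this affects at most the sign of $V_h$.) **Statement.** For every $g_h\in L^2(S_h^n)$, $n=1,\dots,N$, $$\int_{t_{n-1}}^{t_n}\int_{\Gamma_h^n(t)}g_h\,ds_h\,dt=\int_{S_h^n}\frac{g_h}{\sqrt{1+V_h^2}}\,d\sigma_h ,$$ where all integrals exist: $g_h(\cdot,t)$ is integrable on $\Gamma_h^n(t)$ for almost every $t\in I_n$, the inner integral is an integrable function of $t\in I_n$, and $g_h/\sqrt{1+V_h^2}$ is integrable on $S_h^n$. -/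

import Mathlib

open MeasureTheory Set
open scoped MeasureTheory

noncomputable section

namespace SpaceTimeSurface

/-- Physical space, with its Euclidean norm. -/
abbrev E3 : Type := EuclideanSpace ℝ (Fin 3)

/-- Space-time `ℝ³ × ℝ` with the Euclidean norm of `ℝ⁴`; a point is `WithLp.toLp 2 (x, t)`. -/
abbrev ST : Type := WithLp 2 (E3 × ℝ)

/-- The space-time point `(x, t)`. -/
abbrev pt (x : E3) (t : ℝ) : ST := WithLp.toLp 2 (x, t)

/-- The inclusion `x ↦ (x, 0)` of the spatial directions into the space-time directions. -/
def spatialIncl : E3 →L[ℝ] ST :=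
  (WithLp.prodContinuousLinearEquiv 2 ℝ E3 ℝ).symm.toContinuousLinearMap ∘L
    ContinuousLinearMap.inl ℝ E3 ℝ

/-! ### Triangulations and finite element spaces -/

/-- `𝒯` is a (finite, conforming) tetrahedral triangulation of the open set `Ω`. Conformity and
nondegeneracy of the simplices are part of `Geometry.SimplicialComplex`. -/
structure IsTetrahedralTriangulation (𝒯 : Geometry.SimplicialComplex ℝ E3) (Ω : Set E3) :
    Prop where
  finite_faces : 𝒯.faces.Finite
  pure : ∀ s ∈ 𝒯.faces, ∃ K ∈ 𝒯.faces, K.card = 4 ∧ s ⊆ K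
  closure_eq : closure Ω = 𝒯.space

/-- The tetrahedra of a triangulation, given by their vertex sets. -/
def tetrahedra (𝒯 : Geometry.SimplicialComplex ℝ E3) : Set (Finset E3) :=
  {K | K ∈ 𝒯.faces ∧ K.card = 4}

/-- The closed tetrahedron with vertex set `K`. -/
abbrev solid (K : Finset E3) : Set E3 := convexHull ℝ (K : Set E3)

/-- The finite element space `V_h^m`: functions which are continuous on the triangulated (closed)
domain and which are on every tetrahedron a polynomial of total degree at most `m`. -/
def MemFE (𝒯 : Geometry.SimplicialComplex ℝ E3) (m : ℕ) (v : E3 → ℝ) : Prop :=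
  ContinuousOn v 𝒯.space ∧
    ∀ K ∈ tetrahedra 𝒯, ∃ p : MvPolynomial (Fin 3) ℝ, p.totalDegree ≤ m ∧
      ∀ x ∈ solid K, v x = MvPolynomial.eval (fun i => x i) p

/-- Restrictions to one time slab (time interval `I`) of functions in the tensor product space
`V_h^{m_s, m_q}`: `v(x, t) = ∑_{i ≤ m_q} t ^ i v_i(x)` with `v_i ∈ V_h^{m_s}`. -/
def MemSlabFE (𝒯 : Geometry.SimplicialComplex ℝ E3) (I : Set ℝ) (ms mq : ℕ)
    (v : E3 → ℝ → ℝ) : Prop :=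
  ∃ c : ℕ → E3 → ℝ, (∀ i ≤ mq, MemFE 𝒯 ms (c i)) ∧
    ∀ x ∈ 𝒯.space, ∀ t ∈ I, v x t = ∑ i ∈ Finset.range (mq + 1), t ^ i * c i x

/-- `w` are the barycentric coordinates of the point `x` of the simplex with vertex set `s`
(extended by zero to the points that are not vertices of the simplex). -/
def IsBarycentric (s : Finset E3) (x : E3) (w : E3 → ℝ) : Prop :=
  (∀ v ∈ s, 0 ≤ w v) ∧ (∀ v, v ∉ s → w v = 0) ∧ ∑ v ∈ s, w v = 1 ∧ ∑ v ∈ s, w v • v = x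

open Classical in
/-- `hat 𝒯 x v` is the value at `x` of the continuous piecewise linear nodal basis function of the
vertex `v`. -/
def hat (𝒯 : Geometry.SimplicialComplex ℝ E3) (x : E3) : E3 → ℝ :=
  if h : ∃ w, ∃ s ∈ 𝒯.faces, IsBarycentric s x w then h.choose else 0

/-- The nodal interpolation operator `I₁` into the continuous piecewise linear functions. -/
def nodalInterp (𝒯 : Geometry.SimplicialComplex ℝ E3) (u : E3 → ℝ) (x : E3) : ℝ :=
  ∑ᶠ v, hat 𝒯 x v * u v

lemma IsBarycentric.unique {𝒯 : Geometry.SimplicialComplex ℝ E3} {s : Finset E3}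
    (hs : s ∈ 𝒯.faces) {x : E3} {w w' : E3 → ℝ} (h : IsBarycentric s x w)
    (h' : IsBarycentric s x w') : w = w' := by
  have ind := 𝒯.indep hs
  obtain ⟨-, hz, h1, hx⟩ := h
  obtain ⟨-, hz', h1', hx'⟩ := h'
  have e1 : ∑ v : s, w v = 1 := by rw [← h1]; exact Finset.sum_coe_sort s w
  have e1' : ∑ v : s, w' v = 1 := by rw [← h1']; exact Finset.sum_coe_sort s w'
  have key : ∀ v ∈ (Finset.univ : Finset s), w v = w' v := by
    refine (ind.affineCombination_eq_iff_eq (w₁ := fun v : s => w v) (w₂ := fun v : s => w' v)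
      e1 e1').1 ?_
    rw [Finset.affineCombination_eq_linear_combination _ _ _ e1,
      Finset.affineCombination_eq_linear_combination _ _ _ e1']
    rw [Finset.sum_coe_sort s (fun v => w v • v), Finset.sum_coe_sort s (fun v => w' v • v),
      hx, hx']
  funext v
  by_cases hv : v ∈ s
  · exact key ⟨v, hv⟩ (Finset.mem_univ _)
  · rw [hz v hv, hz' v hv]

lemma IsBarycentric.mem_solid {s : Finset E3} {x : E3} {w : E3 → ℝ} (h : IsBarycentric s x w) :
    x ∈ solid s := by
  rw [solid, Finset.mem_convexHull']
  exact ⟨w, h.1, h.2.2.1, h.2.2.2⟩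

lemma IsBarycentric.mono {s t : Finset E3} (hst : s ⊆ t) {x : E3} {w : E3 → ℝ}
    (h : IsBarycentric s x w) : IsBarycentric t x w := by
  obtain ⟨h0, hz, h1, hx⟩ := h
  refine ⟨fun v _ => ?_, fun v hv => hz v (fun hs => hv (hst hs)), ?_, ?_⟩
  · by_cases hv : v ∈ s
    · exact h0 v hv
    · rw [hz v hv]
  · rw [← h1]; exact (Finset.sum_subset hst fun v _ hv => hz v hv).symm
  · rw [← hx]; exact (Finset.sum_subset hst fun v _ hv => by rw [hz v hv, zero_smul]).symm

lemma exists_isBarycentric {s : Finset E3} {x : E3} (h : x ∈ solid s) :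
    ∃ w, IsBarycentric s x w := by
  classical
  rw [solid, Finset.mem_convexHull'] at h
  obtain ⟨w, h0, h1, hx⟩ := h
  refine ⟨fun v => if v ∈ s then w v else 0, ?_, ?_, ?_, ?_⟩
  · intro v hv; simpa [hv] using h0 v hv
  · intro v hv; simp [hv]
  · rw [← h1]; exact Finset.sum_congr rfl fun v hv => by simp [hv]
  · rw [← hx]; exact Finset.sum_congr rfl fun v hv => by simp [hv]

/-- The value of the nodal basis functions does not depend on the simplex used to compute it. -/
lemma hat_eq {𝒯 : Geometry.SimplicialComplex ℝ E3} {s : Finset E3} (hs : s ∈ 𝒯.faces)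
    {x : E3} {w : E3 → ℝ} (h : IsBarycentric s x w) : hat 𝒯 x = w := by
  classical
  have hex : ∃ w, ∃ s ∈ 𝒯.faces, IsBarycentric s x w := ⟨w, s, hs, h⟩
  rw [hat, dif_pos hex]
  obtain ⟨s', hs', h'⟩ := hex.choose_spec
  have hx : x ∈ convexHull ℝ ((s ∩ s' : Finset E3) : Set E3) := by
    rw [Finset.coe_inter]
    exact 𝒯.inter_subset_convexHull hs hs' ⟨h.mem_solid, h'.mem_solid⟩
  obtain ⟨w'', h''⟩ := exists_isBarycentric hx
  rw [← IsBarycentric.unique hs (h''.mono Finset.inter_subset_left) h,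
    ← IsBarycentric.unique hs' (h''.mono Finset.inter_subset_right) h']

/-- On a simplex the nodal interpolant is the affine function with the given vertex values. -/
lemma nodalInterp_eq {𝒯 : Geometry.SimplicialComplex ℝ E3} {s : Finset E3} (hs : s ∈ 𝒯.faces)
    {x : E3} {w : E3 → ℝ} (h : IsBarycentric s x w) (u : E3 → ℝ) :
    nodalInterp 𝒯 u x = ∑ v ∈ s, w v * u v := by
  rw [nodalInterp, hat_eq hs h]
  refine finsum_eq_sum_of_support_subset _ fun v hv => ?_
  by_contra hvs
  exact hv (by simp [h.2.1 v hvs])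

/-! ### The discrete space-time surface -/

/-- The data of the parametric space-time surface approximation: the triangulated spatial domain,
the partition of the time interval, the finite element level set function on every time slab, and
the finite element mesh deformation on every time slab, the latter given by its values at
interpolation points in time. Functions in the tensor product finite element space may jump at the
end points of the time intervals, hence one function per (closed) time slab. -/
structure Discretization where
  /-- the spatial domain -/
  Ω : Set E3
  isOpen_Ω : IsOpen Ω
  /-- the triangulation of the spatial domain -/
  mesh : Geometry.SimplicialComplex ℝ E3
  isTriangulation : IsTetrahedralTriangulation mesh Ω
  /-- the final time -/
  T : ℝ
  /-- the number of time intervals -/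
  N : ℕ
  /-- the partition of the time interval `[0, T]` -/
  time : Fin (N + 1) → ℝ
  time_strictMono : StrictMono time
  time_zero : time 0 = 0
  time_last : time (Fin.last N) = T
  /-- the polynomial degree in space -/
  ks : ℕ
  /-- the polynomial degree in time -/
  kq : ℕ
  /-- the level set function `φ_h`, slab by slab -/
  φ : Fin N → E3 → ℝ → ℝ
  φ_mem : ∀ n, MemSlabFE mesh (Icc (time n.castSucc) (time n.succ)) ks kq (φ n)
  /-- the interpolation points in time -/
  τ : Fin N → Fin (kq + 1) → ℝ
  τ_mem : ∀ n m, τ n m ∈ Icc (time n.castSucc) (time n.succ)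
  τ_injective : ∀ n, Function.Injective (τ n)
  /-- the spatial mesh deformations at the interpolation points -/
  Θnode : (n : Fin N) → Fin (kq + 1) → E3 → E3
  Θnode_mem : ∀ n m i, MemFE mesh ks (fun x => Θnode n m x i)

namespace Discretization

variable (D : Discretization) (n : Fin D.N)

/-- The `n`-th (closed) time interval. -/
def I : Set ℝ := Icc (D.time n.castSucc) (D.time n.succ)

/-- The space-time cylinder `Q_n = Ω × I_n`. -/
def Q : Set ST := {y | y.fst ∈ D.Ω ∧ y.snd ∈ D.I n}

/-- The spatially piecewise linear level set function: for every `t` the nodal interpolant of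
`φ_h(·, t)`. -/
def φhat (x : E3) (t : ℝ) : ℝ := nodalInterp D.mesh (fun z => D.φ n z t) x

/-- The zero level at time `t` of the piecewise linear level set function. -/
def Γlin (t : ℝ) : Set E3 := {x | x ∈ D.Ω ∧ D.φhat n x t = 0}

/-- The zero level in the `n`-th time slab of the spatially piecewise linear level set function. -/
def Slin : Set ST := {y | y ∈ D.Q n ∧ D.φhat n y.fst y.snd = 0}

/-- The tetrahedra which at some time in the slab have an intersection of positive area with
the piecewise linear surface. -/
def cutElements : Set (Finset E3) :=
  {K | K ∈ tetrahedra D.mesh ∧ ∃ t ∈ D.I n, 0 < (μHE[2] : Measure E3) (solid K ∩ D.Γlin n t)}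

/-- The space-time prism `K × I_n`. -/
def prism (K : Finset E3) : Set ST := {y | y.fst ∈ solid K ∧ y.snd ∈ D.I n}

/-- The union of all cut space-time prisms. -/
def QS : Set ST := ⋃ K ∈ D.cutElements n, D.prism n K

/-- The spatial mesh deformation: Lagrange interpolation in time of the deformations given at the
interpolation points. -/
def Θs (x : E3) (t : ℝ) : E3 :=
  ∑ m, (Lagrange.basis Finset.univ (D.τ n) m).eval t • D.Θnode n m x

/-- The space-time mesh deformation `Θ(x, t) = (Θ_s(x, t), t)`. -/
def Θ (y : ST) : ST := pt (D.Θs n y.fst y.snd) y.snd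

/-- The inverse of the space-time mesh deformation, which is considered on the union of the cut
prisms. -/
def Θinv : ST → ST := Function.invFunOn (D.Θ n) (D.QS n)

/-- The discrete space-time surface in the `n`-th time slab. -/
def Sh : Set ST := {y | y ∈ D.Q n ∧ y ∈ D.Θ n '' (D.Slin n ∩ D.QS n)}

/-- The time slices of the discrete space-time surface. -/
def Γh (t : ℝ) : Set E3 := {x | pt x t ∈ D.Sh n}

/-- The space-time derivative of `φhat ∘ Θ⁻¹` on the deformed prism of the tetrahedron `K`. -/
def derivOn (K : Finset E3) (y : ST) : ST →L[ℝ] ℝ :=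
  fderivWithin ℝ (fun z => D.φhat n (D.Θinv n z).fst (D.Θinv n z).snd) (D.Θ n '' D.prism n K) y

/-- The discrete normal velocity `- ∂_t (φhat ∘ Θ⁻¹) / ‖∇ (φhat ∘ Θ⁻¹)‖` on the deformed prism of
the tetrahedron `K`; the denominator is the norm of the spatial part of the derivative. -/
def VhOn (K : Finset E3) (y : ST) : ℝ :=
  -(D.derivOn n K y (pt 0 1)) / ‖D.derivOn n K y ∘L spatialIncl‖

open Classical in
/-- The discrete normal velocity. Derivatives are taken elementwise. At a point of several deformed
prisms one of them is used: at almost all points of the surface this affects at most the sign. -/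
def Vh (y : ST) : ℝ :=
  if h : ∃ K ∈ D.cutElements n, y ∈ D.Θ n '' D.prism n K then D.VhOn n h.choose y else 0

/-- The nondegeneracy that is implicit in the definitions of the discrete normals and of the
discrete normal velocity in the `n`-th slab: the mesh deformation is injective, and on each cut
element the spatial Jacobian of the deformation is invertible and the spatial gradient of the
piecewise linear level set function does not vanish at the points of its zero level. -/
structure IsRegular : Prop where
  injOn : InjOn (D.Θ n) (D.QS n)
  det_ne_zero : ∀ K ∈ D.cutElements n, ∀ x ∈ solid K, ∀ t ∈ D.I n,
    (fderivWithin ℝ (fun z => D.Θs n z t) (solid K) x).det ≠ 0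
  grad_ne_zero : ∀ K ∈ D.cutElements n, ∀ x ∈ solid K, ∀ t ∈ D.I n, pt x t ∈ D.Slin n →
    fderivWithin ℝ (fun z => D.φhat n z t) (solid K) x ≠ 0

end Discretization

end SpaceTimeSurface

end

/-! Near each of its points the deformed surface is almost a hyperplane `⟨ν, x⟩ = V t`, with `ν` a
unit spatial normal and `V` the normal velocity. On that hyperplane `‖x‖² + t² = ‖π x‖² + (1 + V²)
t²`, where `π` gives coordinates of the orthogonal complement of `ν`. So `(x, t) ↦ (π x, √(1 + V²)
t)` maps it isometrically to flat `ℝ³`, and at fixed `t` it is isometric on the slice. In flat space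
the claim is Fubini, and the rescaling of time produces the factor `√(1 + V²)`.

The surface is cut into countably many pieces on which such a chart distorts distances by at most a
factor `K > 1` (`exists_nhds_almost_flat`, `exists_isChart`). Hausdorff measures then change by at
most powers of `K`, so the two sides agree up to `K ^ 6`; now let `K → 1`
(`sliceFormula_of_charts`).

On each cut prism the data agree with `C¹` functions on all of space-time (`exists_isExtension`), so
strict derivatives and the inverse function theorem are available up to the boundary of the prism.
The prisms are glued by `SliceFormula.iUnion`. That the choice of prism does not matter needs no
geometry: densities that satisfy the slice formula have equal integrals over every measurable part
of an overlap, hence agree a.e. there (`SliceFormula.ae_eq`). Finally, the formula for sets is an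
identity of measures, which passes to integrable functions by Fubini for kernels
(`SliceFormula.integral`). -/

noncomputable section

namespace SpaceTimeSurface

open Filter Topology
open scoped NNReal ENNReal

/-! ### Euclidean Hausdorff measure and bilipschitz maps -/

section Bilipschitz

variable {X Y : Type*} [MetricSpace X] [MeasurableSpace X] [BorelSpace X]
  [MetricSpace Y] [MeasurableSpace Y] [BorelSpace Y]

/-- The Euclidean normalization is one scalar depending only on `d`, the same on `X` and on `Y`, so
the Lipschitz bound for `μH[d]` carries over. -/
lemma euclideanHausdorffMeasure_image_le_of_dist_le {f : X → Y} {K : ℝ≥0} {s : Set X}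
    (h : ∀ x ∈ s, ∀ y ∈ s, dist (f x) (f y) ≤ K * dist x y) (d : ℕ) :
    μHE[d] (f '' s) ≤ (K : ℝ≥0∞) ^ d * μHE[d] s := by
  have hL : LipschitzOnWith K f s := LipschitzOnWith.of_dist_le_mul h
  have := hL.hausdorffMeasure_image_le (d := d) (Nat.cast_nonneg d)
  rw [ENNReal.rpow_natCast] at this
  simp only [Measure.euclideanHausdorffMeasure_def, Measure.smul_apply, ENNReal.smul_def,
    smul_eq_mul]
  calc _ ≤ _ := mul_le_mul_right this _
    _ = _ := by ring

lemma euclideanHausdorffMeasure_le_image_of_dist_le {f : X → Y} {K : ℝ≥0} {s : Set X}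
    (h : ∀ x ∈ s, ∀ y ∈ s, dist x y ≤ K * dist (f x) (f y)) (d : ℕ) :
    μHE[d] s ≤ (K : ℝ≥0∞) ^ d * μHE[d] (f '' s) := by
  rcases s.eq_empty_or_nonempty with rfl | ⟨x₀, hx₀⟩
  · simp
  have : Nonempty X := ⟨x₀⟩
  have hinj : InjOn f s := fun x hx y hy hxy => by
    have := h x hx y hy
    rw [hxy, dist_self, mul_zero] at this
    exact dist_le_zero.1 this
  have himg : Function.invFunOn f s '' (f '' s) = s := by
    rw [image_image]
    calc _ = id '' s := image_congr fun x hx => hinj.leftInvOn_invFunOn hx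
      _ = s := image_id s
  conv_lhs => rw [← himg]
  refine euclideanHausdorffMeasure_image_le_of_dist_le ?_ d
  rintro _ ⟨x, hx, rfl⟩ _ ⟨y, hy, rfl⟩
  rw [hinj.leftInvOn_invFunOn hx, hinj.leftInvOn_invFunOn hy]
  exact h x hx y hy

end Bilipschitz

/-! ### Almost isometric charts adapted to the time slices -/

/-- The plane in which the charts of the time slices take their values. -/
abbrev E2 : Type := EuclideanSpace ℝ (Fin 2)

lemma euclideanHausdorffMeasure_E2 : (μHE[2] : Measure E2) = volume :=
  EuclideanSpace.euclideanHausdorffMeasure_eq_volume 2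

lemma euclideanHausdorffMeasure_E2_prod : (μHE[3] : Measure (WithLp 2 (E2 × ℝ))) = volume := by
  have h : Module.finrank ℝ (WithLp 2 (E2 × ℝ)) = 3 := by
    rw [(WithLp.linearEquiv 2 ℝ (E2 × ℝ)).finrank_eq]
    simp
  rw [← h]
  exact InnerProductSpace.euclideanHausdorffMeasure_eq_volume

lemma dist_toLp_same {E : Type*} [SeminormedAddCommGroup E] (x y : E) (t : ℝ) :
    dist (WithLp.toLp 2 (x, t) : WithLp 2 (E × ℝ)) (WithLp.toLp 2 (y, t)) = dist x y := by
  rw [WithLp.prod_dist_eq_of_L2]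
  simp

lemma continuous_pt : Continuous fun p : E3 × ℝ => pt p.1 p.2 :=
  WithLp.prod_continuous_toLp 2 E3 ℝ

lemma measurable_pt_left (t : ℝ) : Measurable fun x : E3 => pt x t :=
  (continuous_pt.comp (Continuous.prodMk_left t)).measurable

/-- The slice at time `t` of a subset of space-time. -/
def slice (A : Set ST) (t : ℝ) : Set E3 := {x | pt x t ∈ A}

lemma measurableSet_slice {A : Set ST} (hA : MeasurableSet A) (t : ℝ) :
    MeasurableSet (slice A t) := measurable_pt_left t hA

/-- The space-time chart with spatial part `π` and with time scaled by `J`. -/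
def stChart (π : E3 → E2) (J : ℝ) (y : ST) : WithLp 2 (E2 × ℝ) :=
  WithLp.toLp 2 (π y.fst, J * y.snd)

/-- `stChart π J` distorts distances in `A` at most by the factor `K`. -/
structure IsChart (K : ℝ≥0) (A : Set ST) (J : ℝ≥0) (π : E3 → E2) : Prop where
  continuous : Continuous π
  pos : 0 < J
  dist_le : ∀ y ∈ A, ∀ z ∈ A, dist (stChart π J y) (stChart π J z) ≤ K * dist y z
  le_dist : ∀ y ∈ A, ∀ z ∈ A, dist y z ≤ K * dist (stChart π J y) (stChart π J z)

lemma dist_stChart_pt (π : E3 → E2) (J t : ℝ) (x y : E3) :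
    dist (stChart π J (pt x t)) (stChart π J (pt y t)) = dist (π x) (π y) :=
  dist_toLp_same _ _ _

lemma continuous_stChart {π : E3 → E2} (hπ : Continuous π) (J : ℝ) :
    Continuous (stChart π J) := by
  refine (WithLp.prod_continuous_toLp 2 E2 ℝ).comp ?_
  have h := WithLp.prod_continuous_ofLp 2 E3 ℝ
  exact (hπ.comp (continuous_fst.comp h)).prodMk
    (continuous_const.mul (continuous_snd.comp h))

namespace IsChart

variable {K J : ℝ≥0} {A B : Set ST} {π : E3 → E2}

lemma mono (h : IsChart K A J π) (hB : B ⊆ A) : IsChart K B J π :=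
  ⟨h.continuous, h.pos, fun y hy z hz => h.dist_le y (hB hy) z (hB hz),
    fun y hy z hz => h.le_dist y (hB hy) z (hB hz)⟩

lemma injOn (h : IsChart K A J π) : InjOn (stChart π J) A := fun y hy z hz hyz => by
  have := h.le_dist y hy z hz
  rw [hyz, dist_self, mul_zero] at this
  exact dist_le_zero.1 this

/-- Two points of a slice have equal times, so space-time distances reduce to spatial ones on both
sides and `π` inherits the distortion factor of the chart. -/
lemma measure_slice_le (h : IsChart K A J π) (t : ℝ) :
    (μHE[2] : Measure E3) (slice A t) ≤ (K : ℝ≥0∞) ^ 2 * volume (π '' slice A t) := by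
  rw [← euclideanHausdorffMeasure_E2]
  refine euclideanHausdorffMeasure_le_image_of_dist_le (fun x hx y hy => ?_) 2
  simpa only [dist_stChart_pt, dist_toLp_same] using h.le_dist _ hx _ hy

lemma volume_image_slice_le (h : IsChart K A J π) (t : ℝ) :
    volume (π '' slice A t) ≤ (K : ℝ≥0∞) ^ 2 * (μHE[2] : Measure E3) (slice A t) := by
  rw [← euclideanHausdorffMeasure_E2]
  refine euclideanHausdorffMeasure_image_le_of_dist_le (fun x hx y hy => ?_) 2
  simpa only [dist_stChart_pt, dist_toLp_same] using h.dist_le _ hx _ hy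

lemma measure_le (h : IsChart K A J π) :
    (μHE[3] : Measure ST) A ≤ (K : ℝ≥0∞) ^ 3 * volume (stChart π J '' A) := by
  rw [← euclideanHausdorffMeasure_E2_prod]
  exact euclideanHausdorffMeasure_le_image_of_dist_le h.le_dist 3

lemma volume_image_le (h : IsChart K A J π) :
    volume (stChart π J '' A) ≤ (K : ℝ≥0∞) ^ 3 * (μHE[3] : Measure ST) A := by
  rw [← euclideanHausdorffMeasure_E2_prod]
  exact euclideanHausdorffMeasure_image_le_of_dist_le h.dist_le 3

lemma preimage_image (h : IsChart K A J π) (t : ℝ) :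
    (fun p => (WithLp.toLp 2 (p, J * t) : WithLp 2 (E2 × ℝ))) ⁻¹' (stChart π J '' A) =
      π '' slice A t := by
  ext p
  simp only [mem_preimage, mem_image, slice, mem_ofPred_eq]
  constructor
  · rintro ⟨y, hy, hyp⟩
    have h1 : π y.fst = p := congrArg (fun q => q.fst) hyp
    have h2 : (J : ℝ) * y.snd = J * t := congrArg (fun q => q.snd) hyp
    have h3 : y.snd = t := mul_left_cancel₀ (NNReal.coe_pos.2 h.pos).ne' h2
    refine ⟨y.fst, ?_, h1⟩
    rw [← h3]
    exact hy
  · rintro ⟨x, hx, rfl⟩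
    exact ⟨pt x t, hx, rfl⟩

/-- Lusin–Souslin: an injective continuous image of a Borel set is Borel. -/
lemma measurableSet_image (h : IsChart K A J π) (hA : MeasurableSet A) :
    MeasurableSet (stChart π J '' A) :=
  hA.image_of_continuousOn_injOn (continuous_stChart h.continuous J).continuousOn h.injOn

lemma measurable_volume_image_slice (h : IsChart K A J π) (hA : MeasurableSet A) :
    Measurable fun t => volume (π '' slice A t) := by
  have hm : MeasurableSet ((WithLp.toLp 2 : E2 × ℝ → _) ⁻¹' (stChart π J '' A)) :=
    (WithLp.prod_continuous_toLp 2 E2 ℝ).measurable (h.measurableSet_image hA)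
  have := (measurable_measure_prodMk_right (μ := (volume : Measure E2)) hm).comp
    (measurable_const_mul (J : ℝ))
  have e : (fun t => volume (π '' slice A t)) = (fun s => volume ((fun p => (p, s)) ⁻¹'
      ((WithLp.toLp 2 : E2 × ℝ → _) ⁻¹' (stChart π J '' A)))) ∘ fun t => (J : ℝ) * t := by
    funext t
    rw [← h.preimage_image t]
    rfl
  rw [e]
  exact this

/-- Fubini in `E2 × ℝ`, followed by the substitution `s = J t`. -/
lemma volume_image_eq (h : IsChart K A J π) (hA : MeasurableSet A) :
    volume (stChart π J '' A) = J * ∫⁻ t, volume (π '' slice A t) := by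
  have hm : MeasurableSet ((WithLp.toLp 2 : E2 × ℝ → _) ⁻¹' (stChart π J '' A)) :=
    (WithLp.prod_continuous_toLp 2 E2 ℝ).measurable (h.measurableSet_image hA)
  have hJ : (J : ℝ) ≠ 0 := (NNReal.coe_pos.2 h.pos).ne'
  rw [← (WithLp.volume_preserving_toLp E2 ℝ).measure_preimage
    (h.measurableSet_image hA).nullMeasurableSet, Measure.volume_eq_prod,
    Measure.prod_apply_symm hm]
  have key : (volume : Measure ℝ) = (J : ℝ≥0∞) • volume.map (fun t => (J : ℝ) * t) := by
    rw [Real.map_volume_mul_left hJ, smul_smul, abs_of_nonneg (by positivity),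
      ENNReal.ofReal_inv_of_pos (NNReal.coe_pos.2 h.pos), ENNReal.ofReal_coe_nnreal,
      ENNReal.mul_inv_cancel (by exact_mod_cast h.pos.ne') ENNReal.coe_ne_top, one_smul]
  conv_lhs => rw [key]
  rw [lintegral_smul_measure, smul_eq_mul, lintegral_map (measurable_measure_prodMk_right hm)
    (measurable_const_mul (J : ℝ))]
  congr 1
  refine lintegral_congr fun t => ?_
  rw [← h.preimage_image t]
  rfl

lemma isBounded_image (h : IsChart K A J π) (hA : Bornology.IsBounded A) :
    Bornology.IsBounded (stChart π J '' A) := by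
  obtain ⟨C, hC⟩ := Metric.isBounded_iff.1 hA
  refine Metric.isBounded_iff.2 ⟨K * C, ?_⟩
  rintro _ ⟨y, hy, rfl⟩ _ ⟨z, hz, rfl⟩
  exact (h.dist_le y hy z hz).trans (mul_le_mul_of_nonneg_left (hC hy hz) K.2)

lemma measure_lt_top (h : IsChart K A J π) (hA : Bornology.IsBounded A) :
    (μHE[3] : Measure ST) A < ∞ :=
  h.measure_le.trans_lt (ENNReal.mul_lt_top (by finiteness) (h.isBounded_image hA).measure_lt_top)

end IsChart

/-! ### Integration over slices -/

/-- On subsets of `S` the integral over time of the area of the slices is the integral of `c` with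
respect to the three-dimensional surface measure. -/
def SliceFormula (S : Set ST) (c : ST → ℝ≥0∞) : Prop :=
  ∀ B ⊆ S, MeasurableSet B → Measurable (fun t => (μHE[2] : Measure E3) (slice B t)) ∧
    ∫⁻ t, (μHE[2] : Measure E3) (slice B t) = ∫⁻ y in B, c y ∂(μHE[3] : Measure ST)

/-- Each point of `B` is assigned to the index with the smallest code among those whose set contains
it. -/
lemma exists_disjoint_iUnion_eq {α ι : Type*} [MeasurableSpace α] [Countable ι] {A : ι → Set α}
    (hA : ∀ i, MeasurableSet (A i)) {B : Set α} (hB : MeasurableSet B) (hBA : B ⊆ ⋃ i, A i) :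
    ∃ C : ι → Set α, (∀ i, MeasurableSet (C i)) ∧ (∀ i, C i ⊆ A i) ∧ (∀ i, C i ⊆ B) ∧
      Pairwise (Function.onFun Disjoint C) ∧ ⋃ i, C i = B := by
  have := Encodable.ofCountable ι
  refine ⟨fun i => (B ∩ A i) \ ⋃ (j : ι) (_ : Encodable.encode j < Encodable.encode i), A j,
    fun i => (hB.inter (hA i)).diff (MeasurableSet.iUnion fun j => MeasurableSet.iUnion
      fun _ => hA j), fun i x hx => hx.1.2, fun i x hx => hx.1.1, ?_, ?_⟩
  · intro i j hij
    rw [Function.onFun, Set.disjoint_left]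
    rintro x ⟨⟨-, hxi⟩, hi⟩ ⟨⟨-, hxj⟩, hj⟩
    simp only [mem_iUnion, not_exists] at hi hj
    rcases lt_trichotomy (Encodable.encode i) (Encodable.encode j) with h | h | h
    · exact hj i h hxi
    · exact hij (Encodable.encode_injective h)
    · exact hi j h hxj
  · refine subset_antisymm (iUnion_subset fun i x hx => hx.1.1) fun x hx => ?_
    have hex : ∃ n, ∃ i, Encodable.encode i = n ∧ x ∈ A i := by
      obtain ⟨i, hi⟩ := mem_iUnion.1 (hBA hx)
      exact ⟨_, i, rfl, hi⟩
    classical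
    obtain ⟨i, hi, hxi⟩ := Nat.find_spec hex
    refine mem_iUnion.2 ⟨i, ⟨hx, hxi⟩, ?_⟩
    simp only [mem_iUnion, not_exists]
    intro j hj hxj
    rw [hi] at hj
    exact Nat.find_min hex hj ⟨j, rfl, hxj⟩

lemma measure_slice_iUnion {ι : Type*} [Countable ι] {C : ι → Set ST}
    (hC : ∀ i, MeasurableSet (C i)) (hd : Pairwise (Function.onFun Disjoint C)) (t : ℝ) :
    (μHE[2] : Measure E3) (slice (⋃ i, C i) t) = ∑' i, (μHE[2] : Measure E3) (slice (C i) t) := by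
  have : slice (⋃ i, C i) t = ⋃ i, slice (C i) t := by
    ext x
    simp [slice]
  rw [this]
  exact measure_iUnion (fun i j hij => (hd hij).preimage _) fun i => measurableSet_slice (hC i) t

/-- A sequence of factors decreasing to `1`. -/
def factor (k : ℕ) : ℝ≥0 := 1 + 1 / ((k : ℝ≥0) + 1)

lemma one_lt_factor (k : ℕ) : 1 < factor k := by
  rw [factor]
  exact lt_add_of_pos_right _ (by positivity)

lemma tendsto_factor : Tendsto factor atTop (𝓝 1) := by
  have := (tendsto_one_div_add_atTop_nhds_zero_nat (𝕜 := ℝ≥0)).const_add 1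
  rwa [add_zero] at this

lemma tendsto_factor_pow_mul (m : ℕ) (a : ℝ≥0∞) :
    Tendsto (fun k => (factor k : ℝ≥0∞) ^ m * a) atTop (𝓝 a) := by
  have h1 : Tendsto (fun k => (factor k : ℝ≥0∞)) atTop (𝓝 1) :=
    ENNReal.tendsto_coe.2 tendsto_factor
  have h2 := ENNReal.Tendsto.mul_const (b := a) (ENNReal.Tendsto.pow (n := m) h1)
    (Or.inl (by simp))
  simpa using h2

lemma tendsto_factor_pow_inv_mul (m : ℕ) (a : ℝ≥0∞) :
    Tendsto (fun k => ((factor k : ℝ≥0∞) ^ m)⁻¹ * a) atTop (𝓝 a) := by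
  have h1 : Tendsto (fun k => (factor k : ℝ≥0∞)) atTop (𝓝 1) :=
    ENNReal.tendsto_coe.2 tendsto_factor
  have h2 := ENNReal.Tendsto.mul_const (b := a)
    (tendsto_inv_iff.2 (ENNReal.Tendsto.pow (n := m) h1)) (Or.inl (by simp))
  simpa using h2

/-- The function `f` sums the flat areas of the charted slices over a disjoint decomposition of `B`.
Each chart costs `K ^ 2` on slices and `K ^ 3` on the surface; replacing `J⁻¹` by `c` costs one
further `K`. -/
lemma exists_approx_measure_slice {K : ℝ≥0} {S B : Set ST} {c : ST → ℝ≥0∞}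
    {ι : Type*} [Countable ι] {A : ι → Set ST} (hA : ∀ i, MeasurableSet (A i))
    (hSA : S ⊆ ⋃ i, A i)
    (hc : ∀ i, ∃ J π, IsChart K (A i) J π ∧
      ∀ y ∈ A i, c y ≤ K * (J : ℝ≥0∞)⁻¹ ∧ (J : ℝ≥0∞)⁻¹ ≤ K * c y)
    (hBS : B ⊆ S) (hB : MeasurableSet B) :
    ∃ f : ℝ → ℝ≥0∞, Measurable f ∧
      (∀ t, (μHE[2] : Measure E3) (slice B t) ≤ (K : ℝ≥0∞) ^ 2 * f t) ∧
      (∀ t, f t ≤ (K : ℝ≥0∞) ^ 2 * (μHE[2] : Measure E3) (slice B t)) ∧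
      ∫⁻ t, f t ≤ (K : ℝ≥0∞) ^ 4 * ∫⁻ y in B, c y ∂(μHE[3] : Measure ST) ∧
      ∫⁻ y in B, c y ∂(μHE[3] : Measure ST) ≤ (K : ℝ≥0∞) ^ 4 * ∫⁻ t, f t := by
  obtain ⟨C, hCm, hCA, -, hCd, rfl⟩ := exists_disjoint_iUnion_eq hA hB (hBS.trans hSA)
  choose J π hch hJ using hc
  have hchC : ∀ i, IsChart K (C i) (J i) (π i) := fun i => (hch i).mono (hCA i)
  have hI : ∀ i, ∫⁻ t, volume (π i '' slice (C i) t) =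
      (J i : ℝ≥0∞)⁻¹ * volume (stChart (π i) (J i) '' C i) := fun i => by
    rw [(hchC i).volume_image_eq (hCm i), ← mul_assoc, ENNReal.inv_mul_cancel
      (by exact_mod_cast (hch i).pos.ne') ENNReal.coe_ne_top, one_mul]
  have hm := fun i => (hchC i).measurable_volume_image_slice (hCm i)
  refine ⟨fun t => ∑' i, volume (π i '' slice (C i) t), Measurable.tsum hm, fun t => ?_,
    fun t => ?_, ?_, ?_⟩
  · rw [measure_slice_iUnion hCm hCd, ← ENNReal.tsum_mul_left]
    exact ENNReal.tsum_le_tsum fun i => (hchC i).measure_slice_le t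
  · rw [measure_slice_iUnion hCm hCd, ← ENNReal.tsum_mul_left]
    exact ENNReal.tsum_le_tsum fun i => (hchC i).volume_image_slice_le t
  · rw [lintegral_tsum fun i => (hm i).aemeasurable, lintegral_iUnion hCm hCd,
      ← ENNReal.tsum_mul_left]
    refine ENNReal.tsum_le_tsum fun i => ?_
    rw [hI]
    calc (J i : ℝ≥0∞)⁻¹ * volume (stChart (π i) (J i) '' C i)
        ≤ (J i : ℝ≥0∞)⁻¹ * (K ^ 3 * (μHE[3] : Measure ST) (C i)) := by
          gcongr
          exact (hchC i).volume_image_le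
      _ = K ^ 3 * ∫⁻ _ in C i, (J i : ℝ≥0∞)⁻¹ ∂(μHE[3] : Measure ST) := by
          rw [setLIntegral_const]
          ring
      _ ≤ K ^ 3 * ∫⁻ y in C i, K * c y ∂(μHE[3] : Measure ST) := by
          gcongr 1
          exact setLIntegral_mono' (hCm i) fun y hy => (hJ i y (hCA i hy)).2
      _ = K ^ 4 * ∫⁻ y in C i, c y ∂(μHE[3] : Measure ST) := by
          rw [lintegral_const_mul' _ _ ENNReal.coe_ne_top]
          ring
  · rw [lintegral_tsum fun i => (hm i).aemeasurable, lintegral_iUnion hCm hCd,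
      ← ENNReal.tsum_mul_left]
    refine ENNReal.tsum_le_tsum fun i => ?_
    rw [hI]
    calc ∫⁻ y in C i, c y ∂(μHE[3] : Measure ST)
        ≤ ∫⁻ _ in C i, K * (J i : ℝ≥0∞)⁻¹ ∂(μHE[3] : Measure ST) :=
          setLIntegral_mono' (hCm i) fun y hy => (hJ i y (hCA i hy)).1
      _ = K * (J i : ℝ≥0∞)⁻¹ * (μHE[3] : Measure ST) (C i) := setLIntegral_const _ _
      _ ≤ K * (J i : ℝ≥0∞)⁻¹ * (K ^ 3 * volume (stChart (π i) (J i) '' C i)) := by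
          gcongr
          exact (hchC i).measure_le
      _ = _ := by ring

/-- A set that can be covered by almost isometric charts satisfies the slice formula. -/
theorem sliceFormula_of_charts {S : Set ST} {c : ST → ℝ≥0∞}
    (h : ∀ K : ℝ≥0, 1 < K → ∃ (ι : Type) (_ : Countable ι) (A : ι → Set ST),
      (∀ i, MeasurableSet (A i)) ∧ S ⊆ ⋃ i, A i ∧
      ∀ i, ∃ J π, IsChart K (A i) J π ∧
        ∀ y ∈ A i, c y ≤ K * (J : ℝ≥0∞)⁻¹ ∧ (J : ℝ≥0∞)⁻¹ ≤ K * c y) :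
    SliceFormula S c := by
  intro B hBS hB
  have key : ∀ k, ∃ f : ℝ → ℝ≥0∞, Measurable f ∧
      (∀ t, (μHE[2] : Measure E3) (slice B t) ≤ (factor k : ℝ≥0∞) ^ 2 * f t) ∧
      (∀ t, f t ≤ (factor k : ℝ≥0∞) ^ 2 * (μHE[2] : Measure E3) (slice B t)) ∧
      ∫⁻ t, f t ≤ (factor k : ℝ≥0∞) ^ 4 * ∫⁻ y in B, c y ∂(μHE[3] : Measure ST) ∧
      ∫⁻ y in B, c y ∂(μHE[3] : Measure ST) ≤ (factor k : ℝ≥0∞) ^ 4 * ∫⁻ t, f t := fun k => by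
    obtain ⟨ι, _, A, hA, hSA, hc⟩ := h (factor k) (one_lt_factor k)
    exact exists_approx_measure_slice hA hSA hc hBS hB
  choose f hf h1 h2 h3 h4 using key
  have hpos : ∀ k (m : ℕ), (factor k : ℝ≥0∞) ^ m ≠ 0 := fun k m => by
    have : (factor k : ℝ≥0∞) ≠ 0 := by exact_mod_cast (zero_lt_one.trans (one_lt_factor k)).ne'
    exact pow_ne_zero m this
  -- The slice area is squeezed out as the pointwise limit of the measurable functions `f k`.
  have hmeas : Measurable fun t => (μHE[2] : Measure E3) (slice B t) := by
    refine measurable_of_tendsto_metrizable hf (tendsto_pi_nhds.2 fun t => ?_)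
    refine tendsto_of_tendsto_of_tendsto_of_le_of_le (tendsto_factor_pow_inv_mul 2 _)
      (tendsto_factor_pow_mul 2 _) (fun k => ?_) fun k => h2 k t
    rw [mul_comm, ← div_eq_mul_inv]
    exact ENNReal.div_le_of_le_mul' (h1 k t)
  refine ⟨hmeas, le_antisymm ?_ ?_⟩
  -- The exponent 6 is 2, for passing between slice areas and `f k`, plus 4, for passing between `∫⁻
  -- f k` and the surface integral.
  · refine ge_of_tendsto' (tendsto_factor_pow_mul 6 _) fun k => ?_
    calc ∫⁻ t, (μHE[2] : Measure E3) (slice B t)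
        ≤ ∫⁻ t, (factor k : ℝ≥0∞) ^ 2 * f k t := lintegral_mono (h1 k)
      _ = (factor k : ℝ≥0∞) ^ 2 * ∫⁻ t, f k t := lintegral_const_mul _ (hf k)
      _ ≤ (factor k : ℝ≥0∞) ^ 2 *
          ((factor k : ℝ≥0∞) ^ 4 * ∫⁻ y in B, c y ∂(μHE[3] : Measure ST)) := by
        gcongr
        exact h3 k
      _ = _ := by ring
  · refine ge_of_tendsto' (tendsto_factor_pow_mul 6 _) fun k => ?_
    calc ∫⁻ y in B, c y ∂(μHE[3] : Measure ST)
        ≤ (factor k : ℝ≥0∞) ^ 4 * ∫⁻ t, f k t := h4 k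
      _ ≤ (factor k : ℝ≥0∞) ^ 4 *
          ∫⁻ t, (factor k : ℝ≥0∞) ^ 2 * (μHE[2] : Measure E3) (slice B t) := by
        gcongr
        exact h2 k _
      _ = (factor k : ℝ≥0∞) ^ 6 * ∫⁻ t, (μHE[2] : Measure E3) (slice B t) := by
        rw [lintegral_const_mul _ hmeas]
        ring

namespace SliceFormula

variable {S S' : Set ST} {c c' : ST → ℝ≥0∞}

/-- Agreement of the densities a.e. on each piece is enough, which leaves room for a density defined
through an arbitrary choice on overlaps. -/
lemma iUnion {ι : Type*} [Countable ι] {S : ι → Set ST} {c' : ι → ST → ℝ≥0∞}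
    (hS : ∀ i, MeasurableSet (S i)) (h : ∀ i, SliceFormula (S i) (c' i))
    (hc : ∀ i, ∀ᵐ y ∂(μHE[3] : Measure ST).restrict (S i), c y = c' i y) :
    SliceFormula (⋃ i, S i) c := by
  intro B hBS hB
  obtain ⟨C, hCm, hCS, -, hCd, rfl⟩ := exists_disjoint_iUnion_eq hS hB hBS
  simp only [measure_slice_iUnion hCm hCd]
  have hi := fun i => h i (C i) (hCS i) (hCm i)
  refine ⟨Measurable.tsum fun i => (hi i).1, ?_⟩
  rw [lintegral_tsum fun i => (hi i).1.aemeasurable, lintegral_iUnion hCm hCd]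
  congr 1
  funext i
  rw [(hi i).2]
  exact lintegral_congr_ae ((ae_restrict_of_ae_restrict_of_subset (hCS i) (hc i)).mono
    fun y hy => hy.symm)

/-- Over a measurable subset of `S ∩ S'` both densities integrate to the same time integral of slice
areas; finiteness of the measure then gives uniqueness of the density. -/
lemma ae_eq (h : SliceFormula S c) (h' : SliceFormula S' c') (hS : MeasurableSet S)
    (hS' : MeasurableSet S') (hfin : (μHE[3] : Measure ST) S ≠ ∞)
    (hc : AEMeasurable c ((μHE[3] : Measure ST).restrict S))
    (hc' : AEMeasurable c' ((μHE[3] : Measure ST).restrict S')) :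
    c =ᵐ[(μHE[3] : Measure ST).restrict (S ∩ S')] c' := by
  have : IsFiniteMeasure ((μHE[3] : Measure ST).restrict (S ∩ S')) :=
    ⟨by
      rw [Measure.restrict_apply_univ]
      exact (measure_mono inter_subset_left).trans_lt hfin.lt_top⟩
  refine ae_eq_of_forall_setLIntegral_eq_of_sigmaFinite₀
    (hc.mono_measure (Measure.restrict_mono inter_subset_left le_rfl))
    (hc'.mono_measure (Measure.restrict_mono inter_subset_right le_rfl)) fun s hs _ => ?_
  rw [Measure.restrict_restrict hs,
    ← (h _ (inter_subset_right.trans inter_subset_left) (hs.inter (hS.inter hS'))).2,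
    ← (h' _ (inter_subset_right.trans inter_subset_right) (hs.inter (hS.inter hS'))).2]

lemma mono (h : SliceFormula S c) (hS : S' ⊆ S) : SliceFormula S' c :=
  fun B hB hm => h B (hB.trans hS) hm

end SliceFormula

lemma isometry_pt (t : ℝ) : Isometry fun x : E3 => pt x t :=
  Isometry.of_dist_eq fun x y => dist_toLp_same x y t

lemma measurableEmbedding_pt (t : ℝ) : MeasurableEmbedding fun x : E3 => pt x t :=
  (isometry_pt t).isClosedEmbedding.measurableEmbedding

/-- The area measure of the slice of `S` at time `t`, as a measure on space-time. -/
def sliceMeasure (S : Set ST) (t : ℝ) : Measure ST :=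
  ((μHE[2] : Measure E3).restrict (slice S t)).map fun x => pt x t

lemma sliceMeasure_apply (S : Set ST) (t : ℝ) {B : Set ST} (hB : MeasurableSet B) :
    sliceMeasure S t B = (μHE[2] : Measure E3) (slice (B ∩ S) t) := by
  rw [sliceMeasure, Measure.map_apply (measurable_pt_left t) hB,
    Measure.restrict_apply (measurable_pt_left t hB)]
  rfl

namespace SliceFormula

variable {S : Set ST} {c : ST → ℝ≥0∞}

lemma measurable_sliceMeasure (h : SliceFormula S c) (hS : MeasurableSet S) :
    Measurable (sliceMeasure S) := by
  refine Measure.measurable_of_measurable_coe _ fun B hB => ?_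
  simp only [sliceMeasure_apply S _ hB]
  exact (h _ inter_subset_right (hB.inter hS)).1

/-- The slice formula restated as an identity of measures: averaging the slice measures over
Lebesgue time gives surface measure with density `c`. The kernel from `Unit` only serves to write
this average as a composition. -/
lemma comp_const_eq (h : SliceFormula S c) (hS : MeasurableSet S) :
    (ProbabilityTheory.Kernel.comp ⟨sliceMeasure S, h.measurable_sliceMeasure hS⟩
      (ProbabilityTheory.Kernel.const Unit (volume : Measure ℝ))) () =
    ((μHE[3] : Measure ST).restrict S).withDensity c := by
  ext B hB
  rw [ProbabilityTheory.Kernel.comp_apply' _ _ _ hB, withDensity_apply _ hB,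
    Measure.restrict_restrict hB, ← (h _ inter_subset_right (hB.inter hS)).2,
    ProbabilityTheory.Kernel.const_apply]
  exact lintegral_congr fun t => sliceMeasure_apply S t hB

/-- The slice formula for integrable functions, with a density that is bounded by `1`. -/
theorem integral {r : ST → ℝ} (h : SliceFormula S fun y => ENNReal.ofReal (r y))
    (h0 : ∀ y, 0 ≤ r y) (h1 : ∀ y, r y ≤ 1) (hS : MeasurableSet S)
    (hr : AEMeasurable r ((μHE[3] : Measure ST).restrict S))
    {a b : ℝ} (hab : a ≤ b) (hSab : ∀ y ∈ S, y.snd ∈ Icc a b) {g : ST → ℝ}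
    (hg : IntegrableOn g S (μHE[3] : Measure ST)) :
    (∀ᵐ t ∂(volume.restrict (Icc a b)),
        IntegrableOn (fun x => g (pt x t)) (slice S t) (μHE[2] : Measure E3)) ∧
      IntegrableOn (fun t => ∫ x in slice S t, g (pt x t) ∂(μHE[2] : Measure E3))
        (Icc a b) volume ∧
      IntegrableOn (fun y => r y * g y) S (μHE[3] : Measure ST) ∧
      ∫ t in a..b, ∫ x in slice S t, g (pt x t) ∂(μHE[2] : Measure E3) =
        ∫ y in S, r y * g y ∂(μHE[3] : Measure ST) := by
  have hquot : IntegrableOn (fun y => r y * g y) S (μHE[3] : Measure ST) := by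
    refine Integrable.mono' hg.norm (hr.mul hg.1.aemeasurable).aestronglyMeasurable
      (ae_of_all _ fun y => ?_)
    rw [norm_mul, Real.norm_of_nonneg (h0 y)]
    exact mul_le_of_le_one_left (norm_nonneg _) (h1 y)
  have hsmul : (fun y => r y * g y) = fun y => (ENNReal.ofReal (r y)).toReal • g y := by
    funext y
    rw [ENNReal.toReal_ofReal (h0 y), smul_eq_mul]
  have hfin : ∀ᵐ y ∂(μHE[3] : Measure ST).restrict S, ENNReal.ofReal (r y) < ∞ :=
    ae_of_all _ fun y => ENNReal.ofReal_lt_top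
  have hcomp := h.comp_const_eq hS
  have hgd : Integrable g (((μHE[3] : Measure ST).restrict S).withDensity
      fun y => ENNReal.ofReal (r y)) := by
    rw [integrable_withDensity_iff_integrable_smul₀' hr.ennreal_ofReal hfin, ← hsmul]
    exact hquot
  have hint := hgd
  rw [← hcomp] at hint
  have hin : ∀ t, ∫ y, g y ∂(sliceMeasure S t) =
      ∫ x in slice S t, g (pt x t) ∂(μHE[2] : Measure E3) := fun t =>
    (measurableEmbedding_pt t).integral_map _
  have hF : Integrable (fun t => ∫ x in slice S t, g (pt x t) ∂(μHE[2] : Measure E3)) := by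
    have := hint.integral_comp
    simp only [ProbabilityTheory.Kernel.const_apply, ProbabilityTheory.Kernel.coe_mk, hin] at this
    exact this
  refine ⟨?_, hF.integrableOn, hquot, ?_⟩
  · have := hint.ae_of_comp
    simp only [ProbabilityTheory.Kernel.const_apply, ProbabilityTheory.Kernel.coe_mk] at this
    refine ae_restrict_of_ae (this.mono fun t ht => ?_)
    exact (measurableEmbedding_pt t).integrable_map_iff.1 ht
  · have h1 := ProbabilityTheory.Kernel.integral_comp hint
    simp only [ProbabilityTheory.Kernel.const_apply, ProbabilityTheory.Kernel.coe_mk, hin,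
      hcomp] at h1
    rw [intervalIntegral.integral_of_le hab, ← integral_Icc_eq_integral_Ioc,
      setIntegral_eq_integral_of_forall_compl_eq_zero, ← h1, hsmul,
      integral_withDensity_eq_integral_toReal_smul₀ hr.ennreal_ofReal hfin]
    -- Outside `[a, b]` the slices are empty, so the integral over all times is the one over `[a,
    -- b]`.
    intro t ht
    have : slice S t = ∅ := eq_empty_of_forall_notMem fun x hx => ht (hSab _ hx)
    rw [this, setIntegral_empty]

end SliceFormula

/-! ### Charts of almost flat sets -/

/-- The normal velocity of the hyperplane `ℓ = 0`. -/
def velocity (ℓ : ST →L[ℝ] ℝ) : ℝ := -(ℓ (pt 0 1)) / ‖ℓ ∘L spatialIncl‖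

lemma spatialIncl_apply (x : E3) : spatialIncl x = pt x 0 := rfl

lemma eq_spatialIncl_add (y : ST) : y = spatialIncl y.fst + y.snd • pt 0 1 := by
  rw [spatialIncl_apply]
  refine WithLp.ofLp_injective 2 (Prod.ext ?_ ?_)
  · show y.fst = y.fst + y.snd • (0 : E3)
    simp
  · show y.snd = 0 + y.snd • (1 : ℝ)
    simp

/-- Coordinates of the orthogonal complement of a unit vector. -/
lemma exists_orthogonal_coordinates {ν : E3} (hν : ‖ν‖ = 1) :
    ∃ π : E3 →ₗ[ℝ] E2, ∀ x, ‖x‖ ^ 2 = ‖π x‖ ^ 2 + inner ℝ ν x ^ 2 := by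
  have ho : Orthonormal ℝ (({0} : Set (Fin 3)).domRestrict fun _ => ν) := by
    refine ⟨fun _ => hν, fun i j hij => ?_⟩
    exact absurd (Subsingleton.elim i j) hij
  obtain ⟨b, hb⟩ := ho.exists_orthonormalBasis_extension_of_card_eq (by simp)
  have hb0 : b 0 = ν := hb 0 rfl
  refine ⟨(WithLp.linearEquiv 2 ℝ (Fin 2 → ℝ)).symm.toLinearMap ∘ₗ
    LinearMap.pi fun i : Fin 2 => (innerₛₗ ℝ (b i.succ)), fun x => ?_⟩
  rw [← b.sum_sq_norm_inner_right x, Fin.sum_univ_succ, hb0, EuclideanSpace.norm_sq_eq]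
  simp [add_comm, Fin.sum_univ_succ]

lemma abs_inner_le_norm_of_unit {ν : E3} (hν : ‖ν‖ = 1) (x : E3) : |inner ℝ ν x| ≤ ‖x‖ := by
  simpa [hν] using abs_real_inner_le_norm ν x

/-- A set that is almost contained in translates of a hyperplane has an almost isometric chart. -/
lemma exists_isChart {ℓ : ST →L[ℝ] ℝ} (hℓ : ℓ ∘L spatialIncl ≠ 0) {K : ℝ≥0} (hK : 1 < K) :
    ∃ ε > 0, ∃ π, ∀ A : Set ST, (∀ y ∈ A, ∀ z ∈ A, |ℓ (y - z)| ≤ ε * ‖y - z‖) →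
      IsChart K A (Real.sqrt (1 + velocity ℓ ^ 2)).toNNReal π := by
  set m := ℓ ∘L spatialIncl with hm
  set α := ‖m‖ with hα
  have hα0 : 0 < α := norm_pos_iff.2 hℓ
  set V := velocity ℓ with hV
  set ν : E3 := α⁻¹ • (InnerProductSpace.toDual ℝ E3).symm m with hνdef
  have hν : ‖ν‖ = 1 := by
    rw [hνdef, norm_smul, LinearIsometryEquiv.norm_map, norm_inv, Real.norm_of_nonneg hα0.le,
      ← hα, inv_mul_cancel₀ hα0.ne']
  have hνm : ∀ x, m x = α * inner ℝ ν x := fun x => by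
    rw [hνdef, real_inner_smul_left, InnerProductSpace.toDual_symm_apply, ← mul_assoc,
      mul_inv_cancel₀ hα0.ne', one_mul]
  have hℓ1 : ℓ (pt 0 1) = -(α * V) := by
    have : V = -(ℓ (pt 0 1)) / α := rfl
    rw [this]
    field_simp
  have hℓeq : ∀ y : ST, ℓ y = α * (inner ℝ ν y.fst - V * y.snd) := fun y => by
    conv_lhs => rw [eq_spatialIncl_add y]
    rw [map_add, map_smul, hℓ1, smul_eq_mul]
    have : ℓ (spatialIncl y.fst) = m y.fst := rfl
    rw [this, hνm]
    ring
  obtain ⟨π, hπ⟩ := exists_orthogonal_coordinates hν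
  have hK' : (1 : ℝ) < K := by exact_mod_cast hK
  -- Chosen so that `K² (1 - η) = 1`, which bounds `dist y z` by the chart distance; the other bound
  -- needs `1 + η ≤ K²`, that is `K² + K⁻² ≥ 2`.
  set η : ℝ := 1 - ((K : ℝ) ^ 2)⁻¹ with hη
  have hK2 : (1 : ℝ) < (K : ℝ) ^ 2 := one_lt_pow₀ hK' two_ne_zero
  have hη0 : 0 < η := sub_pos.2 (inv_lt_one_of_one_lt₀ hK2)
  have hKη : (K : ℝ) ^ 2 * (1 - η) = 1 := by
    rw [hη]
    field_simp
    ring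
  have hKη' : 1 + η ≤ (K : ℝ) ^ 2 := by nlinarith
  -- The factor `α` converts `ℓ` to the normalized form `⟨ν, x⟩ - V t`; the factor `1 + |V|` will
  -- cancel against the bound for `⟨ν, x⟩ + V t`.
  refine ⟨η * α / (1 + |V|), by positivity, π, fun A hA => ?_⟩
  have hJ2 : (((Real.sqrt (1 + V ^ 2)).toNNReal : ℝ≥0) : ℝ) ^ 2 = 1 + V ^ 2 := by
    rw [Real.coe_toNNReal _ (Real.sqrt_nonneg _), Real.sq_sqrt (by positivity)]
  set J := (Real.sqrt (1 + V ^ 2)).toNNReal with hJ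
  have key : ∀ y ∈ A, ∀ z ∈ A,
      |dist (stChart π J y) (stChart π J z) ^ 2 - dist y z ^ 2| ≤ η * dist y z ^ 2 := by
    intro y hy z hz
    set x := (y - z).fst with hx
    set t := (y - z).snd with ht
    have hx' : y.fst - z.fst = x := rfl
    have ht' : y.snd - z.snd = t := rfl
    have e1 : dist y z ^ 2 = ‖x‖ ^ 2 + t ^ 2 := by
      rw [dist_eq_norm, WithLp.prod_norm_sq_eq_of_L2, Real.norm_eq_abs, sq_abs]
    have e2 : dist (stChart π J y) (stChart π J z) ^ 2 = ‖π x‖ ^ 2 + (J : ℝ) ^ 2 * t ^ 2 := by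
      rw [dist_eq_norm, WithLp.prod_norm_sq_eq_of_L2]
      have a1 : (stChart π J y - stChart π J z).fst = π x := by
        rw [← hx', map_sub]
        rfl
      have a2 : (stChart π J y - stChart π J z).snd = J * t := by
        rw [← ht', mul_sub]
        rfl
      rw [a1, a2, Real.norm_eq_abs, sq_abs, mul_pow]
    have hd0 : 0 ≤ dist y z := dist_nonneg
    have hxd : ‖x‖ ≤ dist y z := abs_le_of_sq_le_sq' (by nlinarith [sq_nonneg t]) hd0 |>.2
    have htd : |t| ≤ dist y z :=
      abs_le_of_sq_le_sq' (by rw [sq_abs]; nlinarith [sq_nonneg ‖x‖]) hd0 |>.2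
    have e3 : |inner ℝ ν x - V * t| ≤ η / (1 + |V|) * dist y z := by
      have := hA y hy z hz
      rw [hℓeq, abs_mul, abs_of_pos hα0, ← dist_eq_norm] at this
      have h2 : α * |inner ℝ ν x - V * t| ≤ α * (η / (1 + |V|) * dist y z) := by
        calc _ ≤ _ := this
          _ = _ := by ring
      exact le_of_mul_le_mul_left h2 hα0
    have e4 : |inner ℝ ν x + V * t| ≤ (1 + |V|) * dist y z := by
      calc |inner ℝ ν x + V * t| ≤ |inner ℝ ν x| + |V| * |t| := by
            rw [← abs_mul]; exact abs_add_le _ _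
        _ ≤ dist y z + |V| * dist y z := by
            gcongr
            exact (abs_inner_le_norm_of_unit hν x).trans hxd
        _ = _ := by ring
    -- With `J² = 1 + V²` the defect is a difference of squares, `(V t)² - ⟨ν, x⟩²`, one factor of
    -- which is small by flatness.
    have e5 : dist (stChart π J y) (stChart π J z) ^ 2 - dist y z ^ 2 =
        -((inner ℝ ν x - V * t) * (inner ℝ ν x + V * t)) := by
      rw [e1, e2, hJ2, hπ x]
      ring
    rw [e5, abs_neg, abs_mul]
    calc _ ≤ (η / (1 + |V|) * dist y z) * ((1 + |V|) * dist y z) := by gcongr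
      _ = η * dist y z ^ 2 := by field_simp
  refine ⟨π.continuous_of_finiteDimensional, ?_, fun y hy z hz => ?_, fun y hy z hz => ?_⟩
  · exact Real.toNNReal_pos.2 (Real.sqrt_pos.2 (by positivity))
  · refine abs_le_of_sq_le_sq' ?_ (by positivity) |>.2
    have := (abs_le.1 (key y hy z hz)).2
    rw [mul_pow]
    nlinarith [sq_nonneg (dist y z)]
  · refine abs_le_of_sq_le_sq' ?_ (by positivity) |>.2
    have := (abs_le.1 (key y hy z hz)).1
    rw [mul_pow]
    have h2 : (K : ℝ) ^ 2 * ((1 - η) * dist y z ^ 2) ≤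
        (K : ℝ) ^ 2 * dist (stChart π J y) (stChart π J z) ^ 2 := by
      gcongr
      linarith
    rw [← mul_assoc, hKη, one_mul] at h2
    exact h2

/-- The zero set of `φ`, deformed by `Θ`, is locally almost contained in a hyperplane. -/
lemma exists_nhds_almost_flat {E F : Type*} [NormedAddCommGroup E] [NormedSpace ℝ E]
    [CompleteSpace E] [NormedAddCommGroup F] [NormedSpace ℝ F] {Θ : E → F} {φ : E → ℝ}
    {L : E ≃L[ℝ] F} {m : E →L[ℝ] ℝ} {z₀ : E} (hΘ : HasStrictFDerivAt Θ (L : E →L[ℝ] F) z₀)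
    (hφ : HasStrictFDerivAt φ m z₀) {ε : ℝ} (hε : 0 < ε) :
    ∃ U ∈ 𝓝 z₀, ∀ z₁ ∈ U, ∀ z₂ ∈ U, φ z₁ = φ z₂ →
      |(m ∘L (L.symm : F →L[ℝ] E)) (Θ z₁ - Θ z₂)| ≤ ε * ‖Θ z₁ - Θ z₂‖ := by
  have hinv := hΘ.to_localInverse
  have hleft := hΘ.eventually_left_inverse
  have hz : hΘ.localInverse Θ L z₀ (Θ z₀) = z₀ := hΘ.localInverse_apply_image
  have hcomp : HasStrictFDerivAt (φ ∘ hΘ.localInverse Θ L z₀) (m ∘L (L.symm : F →L[ℝ] E))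
      (Θ z₀) := by
    refine HasStrictFDerivAt.comp (Θ z₀) ?_ hinv
    rwa [hz]
  have hb := (hcomp.isLittleO.bound hε)
  have ht : Tendsto (fun p : E × E => (Θ p.1, Θ p.2)) (𝓝 (z₀, z₀)) (𝓝 (Θ z₀, Θ z₀)) :=
    ((hΘ.continuousAt.comp continuousAt_fst).prodMk_nhds (hΘ.continuousAt.comp continuousAt_snd))
  have hev := ht.eventually hb
  rw [nhds_prod_eq] at hev
  have hall := hev.and (hleft.prod_mk hleft)
  obtain ⟨U, hU, hUp⟩ := mem_prod_self_iff.1 hall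
  refine ⟨U, hU, fun z₁ h₁ z₂ h₂ heq => ?_⟩
  obtain ⟨h, e₁, e₂⟩ := hUp (mk_mem_prod h₁ h₂)
  -- The two values of `φ` cancel, so the `o(‖Θ z₁ - Θ z₂‖)` remainder of `φ ∘ Θ⁻¹` is the linear
  -- form itself.
  simp only [Function.comp_apply, e₁, e₂, heq, sub_self, zero_sub, norm_neg] at h
  exact h

/-! ### Tetrahedra -/

section Tetrahedra

variable {𝒯 : Geometry.SimplicialComplex ℝ E3} {K : Finset E3}

lemma affineSpan_tetrahedron (hK : K ∈ tetrahedra 𝒯) :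
    affineSpan ℝ (range ((↑) : K → E3)) = ⊤ := by
  rw [(𝒯.indep hK.1).affineSpan_eq_top_iff_card_eq_finrank_add_one]
  simp [hK.2]

lemma interior_solid_nonempty (hK : K ∈ tetrahedra 𝒯) : (interior (solid K)).Nonempty := by
  rw [interior_convexHull_nonempty_iff_affineSpan_eq_top]
  simpa using affineSpan_tetrahedron hK

lemma uniqueDiffOn_solid (hK : K ∈ tetrahedra 𝒯) : UniqueDiffOn ℝ (solid K) :=
  uniqueDiffOn_convex (convex_convexHull ℝ _) (interior_solid_nonempty hK)

lemma isCompact_solid (K : Finset E3) : IsCompact (solid K) :=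
  K.finite_toSet.isCompact_convexHull ℝ

lemma vertex_mem_solid {v : E3} (hv : v ∈ K) : v ∈ solid K :=
  subset_convexHull ℝ _ hv

/-- The barycentric coordinates extend to affine functions on all of `E3`. They do not depend on
`u`, so for `φhat` time enters only through the vertex values. -/
lemma nodalInterp_eq_affine (hK : K ∈ tetrahedra 𝒯) :
    ∃ (a : K → E3 →L[ℝ] ℝ) (b : K → ℝ), ∀ u, ∀ x ∈ solid K,
      nodalInterp 𝒯 u x = ∑ v : K, (a v x + b v) * u v := by
  let B : AffineBasis K ℝ E3 := ⟨(↑), 𝒯.indep hK.1, affineSpan_tetrahedron hK⟩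
  refine ⟨fun v => (B.coord v).linear.toContinuousLinearMap, fun v => B.coord v 0,
    fun u x hx => ?_⟩
  obtain ⟨w, hw⟩ := exists_isBarycentric hx
  rw [nodalInterp_eq hK.1 hw, ← Finset.sum_coe_sort K]
  refine Finset.sum_congr rfl fun v _ => ?_
  congr 1
  have h1 : ∑ v : K, w v = 1 := by
    rw [← hw.2.2.1]
    exact Finset.sum_coe_sort K w
  have hx' : x = Finset.univ.affineCombination ℝ B (fun v : K => w v) := by
    rw [Finset.affineCombination_eq_linear_combination _ _ _ h1, ← hw.2.2.2]
    exact (Finset.sum_coe_sort K fun v => w v • v).symm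
  have h2 : B.coord v x = w v := by
    rw [hx']
    exact B.coord_apply_combination_of_mem (Finset.mem_univ v) h1
  rw [← h2]
  exact congrFun (AffineMap.decomp (B.coord v)) x

end Tetrahedra

/-! ### Derivatives of maps on space-time -/

lemma continuousSMul_of_normedSpace {E : Type*} [NormedAddCommGroup E] [NormedSpace ℝ E] :
    ContinuousSMul ℝ E := inferInstance

/-- A shortcut instance: the general search unfolds the topology of `WithLp`. -/
instance : ContinuousSMul ℝ ST := continuousSMul_of_normedSpace

lemma hasFDerivAt_pt (x : E3) (t : ℝ) : HasFDerivAt (fun x : E3 => pt x t) spatialIncl x := by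
  have h1 : (fun x : E3 => pt x t) = fun x => spatialIncl x + pt 0 t := by
    funext x
    rw [spatialIncl_apply]
    refine WithLp.ofLp_injective 2 (Prod.ext ?_ ?_)
    · show x = x + 0
      simp
    · show t = 0 + t
      simp
  rw [h1]
  exact spatialIncl.hasFDerivAt.add_const _

lemma hasFDerivAt_comp_pt {G : Type*} [NormedAddCommGroup G] [NormedSpace ℝ G] {f : ST → G}
    {f' : ST →L[ℝ] G} {z : ST} (h : HasFDerivAt f f' z) :
    HasFDerivAt (fun x => f (pt x z.snd)) (f' ∘L spatialIncl) z.fst :=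
  HasFDerivAt.comp (g := f) z.fst h (hasFDerivAt_pt z.fst z.snd)

/-- This makes the derivative of a time-preserving map block triangular. -/
lemma snd_hasFDerivAt {Θ : ST → ST} (hΘ : ∀ z, (Θ z).snd = z.snd) {f' : ST →L[ℝ] ST} {z : ST}
    (h : HasFDerivAt Θ f' z) (w : ST) : (f' w).snd = w.snd := by
  have h1 : HasFDerivAt (fun z : ST => WithLp.sndL 2 ℝ E3 ℝ (Θ z))
      ((WithLp.sndL 2 ℝ E3 ℝ) ∘L f') z := (WithLp.sndL 2 ℝ E3 ℝ).hasFDerivAt.comp z h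
  have h2 : (fun z : ST => WithLp.sndL 2 ℝ E3 ℝ (Θ z)) = WithLp.sndL 2 ℝ E3 ℝ := funext hΘ
  rw [h2] at h1
  exact DFunLike.congr_fun (h1.unique (WithLp.sndL 2 ℝ E3 ℝ).hasFDerivAt) w

/-- The derivative of `φ ∘ Θ⁻¹` at the image of `z`. -/
def tangentForm (φ : ST → ℝ) (Θ : ST → ST) (z : ST) : ST →L[ℝ] ℝ :=
  fderiv ℝ φ z ∘L (fderiv ℝ Θ z).inverse

/-! ### Smooth extensions of the level set function and the deformation from a cut prism -/

namespace Discretization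

variable (D : Discretization) (n : Fin D.N) {K : Finset E3}

lemma time_lt : D.time n.castSucc < D.time n.succ := D.time_strictMono Fin.castSucc_lt_succ

lemma φhat_eq_affine (hK : K ∈ tetrahedra D.mesh) :
    ∃ (a : ℝ → E3 →L[ℝ] ℝ) (b : ℝ → ℝ), ContDiff ℝ 1 a ∧ ContDiff ℝ 1 b ∧
      ∀ x ∈ solid K, ∀ t ∈ D.I n, D.φhat n x t = a t x + b t := by
  obtain ⟨a, b, hab⟩ := nodalInterp_eq_affine hK
  obtain ⟨c, -, hc⟩ := D.φ_mem n
  refine ⟨fun t => ∑ v : K, (∑ i ∈ Finset.range (D.kq + 1), t ^ i * c i v) • a v,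
    fun t => ∑ v : K, (∑ i ∈ Finset.range (D.kq + 1), t ^ i * c i v) * b v, ?_, ?_, ?_⟩
  · fun_prop
  · fun_prop
  · intro x hx t ht
    rw [φhat, hab _ x hx]
    simp only [sum_apply, smul_apply, smul_eq_mul]
    rw [← Finset.sum_add_distrib]
    refine Finset.sum_congr rfl fun v _ => ?_
    have hv : (v : E3) ∈ D.mesh.space :=
      D.mesh.convexHull_subset_space hK.1 (vertex_mem_solid v.2)
    rw [hc v hv t ht]
    ring

lemma Θs_eq_smooth (hK : K ∈ tetrahedra D.mesh) :
    ∃ F : E3 → ℝ → E3, ContDiff ℝ 1 (fun p : E3 × ℝ => F p.1 p.2) ∧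
      ∀ x ∈ solid K, ∀ t, D.Θs n x t = F x t := by
  choose p _ hp using fun m i => (D.Θnode_mem n m i).2 K hK
  refine ⟨fun x t => ∑ m, (Lagrange.basis Finset.univ (D.τ n) m).eval t •
    WithLp.toLp 2 fun i => MvPolynomial.eval (fun j => x j) (p m i), ?_, ?_⟩
  · refine ContDiff.sum fun m _ => ContDiff.fun_smul ?_ ?_
    · exact ((Polynomial.contDiff_aeval (𝕜 := ℝ) (Lagrange.basis Finset.univ (D.τ n) m) 1)).comp
        contDiff_snd
    · rw [contDiff_euclidean]
      intro i
      have h1 : ContDiff ℝ 1 fun x : Fin 3 → ℝ => MvPolynomial.eval x (p m i) :=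
        (AnalyticOnNhd.eval_mvPolynomial (p m i)).contDiff
      exact h1.comp (contDiff_pi.2 fun j => contDiff_euclidean.1 contDiff_fst j)
  · intro x hx t
    rw [Θs]
    refine Finset.sum_congr rfl fun m _ => ?_
    congr 1
    ext i
    exact hp m i x hx

/-- `φ` and `Θ` are continuously differentiable extensions of the level set function and of the
mesh deformation on the prism of `K`, with invertible derivative of `Θ` and with non-vanishing
spatial gradient of the deformed level set function on its zero set. -/
structure IsExtension (K : Finset E3) (φ : ST → ℝ) (Θ : ST → ST) : Prop where
  contDiff_φ : ContDiff ℝ 1 φ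
  contDiff_Θ : ContDiff ℝ 1 Θ
  φ_eq : ∀ z ∈ D.prism n K, D.φhat n z.fst z.snd = φ z
  Θ_eq : ∀ z ∈ D.prism n K, D.Θ n z = Θ z
  isInvertible : ∀ z ∈ D.prism n K, (fderiv ℝ Θ z).IsInvertible
  grad_ne_zero : ∀ z ∈ D.prism n K, φ z = 0 → tangentForm φ Θ z ∘L spatialIncl ≠ 0

variable {D n}

/-- Regularity speaks only of points in `Ω`, but compactness arguments need the whole closed prism.
If `a t = 0` at a zero, then `φhat` vanishes at time `t` on all of `K`, whose interior meets `Ω`;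
the gradient would vanish at a zero in `Ω`. -/
lemma affine_part_ne_zero (hD : D.IsRegular n) (hK : K ∈ D.cutElements n) {a : ℝ → E3 →L[ℝ] ℝ}
    {b : ℝ → ℝ} (hab : ∀ x ∈ solid K, ∀ t ∈ D.I n, D.φhat n x t = a t x + b t) {x : E3}
    (hx : x ∈ solid K) {t : ℝ} (ht : t ∈ D.I n) (h0 : D.φhat n x t = 0) : a t ≠ 0 := by
  intro ha
  have hb : b t = 0 := by
    have := hab x hx t ht
    rw [h0, ha] at this
    simpa using this.symm
  obtain ⟨x', hx'⟩ := interior_solid_nonempty hK.1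
  have hcl : x' ∈ closure D.Ω := by
    rw [D.isTriangulation.closure_eq]
    exact D.mesh.convexHull_subset_space hK.1.1 (interior_subset hx')
  obtain ⟨x₁, hx₁, hΩ⟩ := mem_closure_iff.1 hcl _ isOpen_interior hx'
  have hz : ∀ z ∈ solid K, D.φhat n z t = 0 := fun z hz => by
    rw [hab z hz t ht, ha, hb]
    simp
  refine hD.grad_ne_zero K hK x₁ (interior_subset hx₁) t ht
    ⟨⟨hΩ, ht⟩, hz x₁ (interior_subset hx₁)⟩ ?_
  rw [fderivWithin_congr hz (hz x₁ (interior_subset hx₁)), fderivWithin_const_apply]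

lemma exists_isExtension (hD : D.IsRegular n) (hK : K ∈ D.cutElements n) :
    ∃ φ Θ, D.IsExtension n K φ Θ := by
  obtain ⟨a, b, ha, hb, hab⟩ := D.φhat_eq_affine n hK.1
  obtain ⟨F, hF, hFΘ⟩ := D.Θs_eq_smooth n hK.1
  have hfst : ContDiff ℝ 1 fun z : ST => z.fst := (WithLp.fstL 2 ℝ E3 ℝ).contDiff
  have hsnd : ContDiff ℝ 1 fun z : ST => z.snd := (WithLp.sndL 2 ℝ E3 ℝ).contDiff
  have hφ : ContDiff ℝ 1 fun z : ST => a z.snd z.fst + b z.snd :=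
    ((ha.comp hsnd).clm_apply hfst).add (hb.comp hsnd)
  have hΘ : ContDiff ℝ 1 fun z : ST => pt (F z.fst z.snd) z.snd :=
    (WithLp.prodContinuousLinearEquiv 2 ℝ E3 ℝ).symm.contDiff.comp
      ((hF.comp (hfst.prodMk hsnd)).prodMk hsnd)
  obtain ⟨φ, hφdef⟩ : ∃ φ : ST → ℝ, φ = fun z => a z.snd z.fst + b z.snd := ⟨_, rfl⟩
  obtain ⟨Θ, hΘdef⟩ : ∃ Θ : ST → ST, Θ = fun z => pt (F z.fst z.snd) z.snd := ⟨_, rfl⟩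
  rw [← hφdef] at hφ
  rw [← hΘdef] at hΘ
  have hφpt : ∀ x t, φ (pt x t) = a t x + b t := fun x t => by subst hφdef; rfl
  have hΘpt : ∀ x t, Θ (pt x t) = pt (F x t) t := fun x t => by subst hΘdef; rfl
  have hΘd : ∀ z, HasFDerivAt Θ (fderiv ℝ Θ z) z := fun z =>
    (hΘ.differentiable one_ne_zero z).hasFDerivAt
  have hφd : ∀ z, HasFDerivAt φ (fderiv ℝ φ z) z := fun z =>
    (hφ.differentiable one_ne_zero z).hasFDerivAt
  have hΘsnd : ∀ z w, (fderiv ℝ Θ z w).snd = w.snd := fun z w =>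
    snd_hasFDerivAt (fun z => by subst hΘdef; rfl) (hΘd z) w
  have hFd : ∀ z : ST, HasFDerivAt (fun x => F x z.snd)
      ((WithLp.fstL 2 ℝ E3 ℝ) ∘L (fderiv ℝ Θ z ∘L spatialIncl)) z.fst := fun z => by
    have h1 := hasFDerivAt_comp_pt (hΘd z)
    simp only [hΘpt] at h1
    exact (WithLp.fstL 2 ℝ E3 ℝ).hasFDerivAt.comp z.fst h1
  have hφx : ∀ (z : ST) x, fderiv ℝ φ z (spatialIncl x) = a z.snd x := fun z x => by
    have h1 := hasFDerivAt_comp_pt (hφd z)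
    simp only [hφpt] at h1
    exact DFunLike.congr_fun (h1.unique ((a z.snd).hasFDerivAt.add_const (b z.snd))) x
  -- A kernel vector has time component zero, because the derivative of `Θ` preserves it; it is
  -- therefore spatial, and there the derivative acts by the invertible spatial Jacobian.
  have hinj : ∀ z ∈ D.prism n K, Function.Injective (fderiv ℝ Θ z) := by
    rintro z ⟨hz1, hz2⟩
    have hdet := hD.det_ne_zero K hK z.fst hz1 z.snd hz2
    have heq : fderivWithin ℝ (fun x => D.Θs n x z.snd) (solid K) z.fst =
        (WithLp.fstL 2 ℝ E3 ℝ) ∘L fderiv ℝ Θ z ∘L spatialIncl :=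
      ((hFd z).hasFDerivWithinAt.congr (fun x hx => hFΘ x hx z.snd)
        (hFΘ z.fst hz1 z.snd)).fderivWithin (uniqueDiffOn_solid hK.1 z.fst hz1)
    rw [heq] at hdet
    rw [injective_iff_map_eq_zero]
    intro w hw
    have hw2 : w.snd = 0 := by
      rw [← hΘsnd z w, hw]
      rfl
    have hw' : w = spatialIncl w.fst := by
      conv_lhs => rw [eq_spatialIncl_add w, hw2, zero_smul, add_zero]
    have hz : ((WithLp.fstL 2 ℝ E3 ℝ) ∘L fderiv ℝ Θ z ∘L spatialIncl) w.fst = 0 := by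
      show (fderiv ℝ Θ z (spatialIncl w.fst)).fst = 0
      rw [← hw', hw]
      rfl
    have h0 : w.fst = 0 :=
      (ContinuousLinearMap.toContinuousLinearEquivOfDetNeZero _ hdet).injective
        (hz.trans (map_zero _).symm)
    rw [hw', h0, map_zero]
  have hinv : ∀ z ∈ D.prism n K, ∃ L : ST ≃L[ℝ] ST, (L : ST →L[ℝ] ST) = fderiv ℝ Θ z :=
    fun z hz => ⟨(LinearEquiv.ofInjectiveEndo (fderiv ℝ Θ z : ST →ₗ[ℝ] ST)
      (hinj z hz)).toContinuousLinearEquiv, by ext : 1; rfl⟩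
  have hφeq : ∀ z ∈ D.prism n K, D.φhat n z.fst z.snd = φ z := fun z hz =>
    (hab z.fst hz.1 z.snd hz.2).trans (by rw [hφdef])
  refine ⟨φ, Θ, hφ, hΘ, hφeq, fun z hz => ?_, hinv, fun z hz h0 h => ?_⟩
  · rw [Discretization.Θ, hFΘ z.fst hz.1, hΘdef]
  · refine affine_part_ne_zero hD hK hab hz.1 hz.2 ((hφeq z hz).trans h0) ?_
    obtain ⟨L, hL⟩ := hinv z hz
    ext x
    -- `L` maps spatial directions to spatial ones, so testing `tangentForm` on the image of `x`
    -- returns the undeformed spatial derivative `a z.snd x`.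
    have h1 : L (spatialIncl x) = spatialIncl (L (spatialIncl x)).fst := by
      have : (L (spatialIncl x)).snd = 0 := by
        have h2 : L (spatialIncl x) = fderiv ℝ Θ z (spatialIncl x) := by rw [← hL]; rfl
        rw [h2, hΘsnd]
        rfl
      conv_lhs => rw [eq_spatialIncl_add (L (spatialIncl x)), this, zero_smul, add_zero]
    have h3 := DFunLike.congr_fun h (L (spatialIncl x)).fst
    rw [tangentForm, ← hL, ContinuousLinearMap.inverse_equiv] at h3
    simp only [ContinuousLinearMap.comp_apply, ← h1, ContinuousLinearEquiv.coe_coe,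
      ContinuousLinearEquiv.symm_apply_apply, hφx] at h3
    exact h3

end Discretization

/-! ### The slice formula on a single deformed prism -/

namespace Discretization

variable {D : Discretization} {n : Fin D.N} {K : Finset E3} {φ : ST → ℝ} {Θ : ST → ST}

lemma prism_eq_preimage : D.prism n K =
    WithLp.prodContinuousLinearEquiv 2 ℝ E3 ℝ ⁻¹' (solid K ×ˢ D.I n) := rfl

lemma isCompact_prism : IsCompact (D.prism n K) := by
  rw [prism_eq_preimage]
  exact (WithLp.prodContinuousLinearEquiv 2 ℝ E3 ℝ).toHomeomorph.isCompact_preimage.2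
    ((isCompact_solid K).prod isCompact_Icc)

lemma uniqueDiffOn_prism (hK : K ∈ tetrahedra D.mesh) : UniqueDiffOn ℝ (D.prism n K) := by
  rw [prism_eq_preimage]
  exact (WithLp.prodContinuousLinearEquiv 2 ℝ E3 ℝ).uniqueDiffOn_preimage_iff.2
    ((uniqueDiffOn_solid hK).prod (uniqueDiffOn_Icc (D.time_lt n)))

lemma prism_subset_QS (hK : K ∈ D.cutElements n) : D.prism n K ⊆ D.QS n :=
  subset_biUnion_of_mem hK

lemma Θinv_Θ (hD : D.IsRegular n) (hK : K ∈ D.cutElements n) {z : ST} (hz : z ∈ D.prism n K) :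
    D.Θinv n (D.Θ n z) = z :=
  hD.injOn.leftInvOn_invFunOn (prism_subset_QS hK hz)

/-- The part of the zero set of `φ` in the prism of `K`. -/
def zeroSet (D : Discretization) (n : Fin D.N) (K : Finset E3) (φ : ST → ℝ) : Set ST :=
  D.prism n K ∩ {z | φ z = 0}

namespace IsExtension

lemma hasStrictFDerivAt_φ (h : D.IsExtension n K φ Θ) (z : ST) :
    HasStrictFDerivAt φ (fderiv ℝ φ z) z :=
  h.contDiff_φ.contDiffAt.hasStrictFDerivAt one_ne_zero

lemma hasStrictFDerivAt_Θ (h : D.IsExtension n K φ Θ) (z : ST) :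
    HasStrictFDerivAt Θ (fderiv ℝ Θ z) z :=
  h.contDiff_Θ.contDiffAt.hasStrictFDerivAt one_ne_zero

lemma image_eq (h : D.IsExtension n K φ Θ) : D.Θ n '' D.prism n K = Θ '' D.prism n K :=
  image_congr h.Θ_eq

lemma injOn (h : D.IsExtension n K φ Θ) (hD : D.IsRegular n) (hK : K ∈ D.cutElements n) :
    InjOn Θ (D.prism n K) :=
  (hD.injOn.mono (prism_subset_QS hK)).congr h.Θ_eq

/-- The inverse of a continuous injection of a compact set is continuous: by continuity, a cluster
point `z'` of the preimages satisfies `Θ z' = Θ z`. -/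
lemma tendsto_Θinv (h : D.IsExtension n K φ Θ) (hD : D.IsRegular n) (hK : K ∈ D.cutElements n)
    {z : ST} (hz : z ∈ D.prism n K) :
    Tendsto (D.Θinv n) (𝓝[Θ '' D.prism n K] (Θ z)) (𝓝[D.prism n K] z) := by
  have hmem : ∀ y ∈ Θ '' D.prism n K, D.Θinv n y ∈ D.prism n K ∧ Θ (D.Θinv n y) = y := by
    rintro _ ⟨z', hz', rfl⟩
    rw [← h.Θ_eq z' hz', Θinv_Θ hD hK hz', h.Θ_eq z' hz']
    exact ⟨hz', rfl⟩
  have hev : ∀ᶠ y in 𝓝[Θ '' D.prism n K] (Θ z), D.Θinv n y ∈ D.prism n K :=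
    eventually_mem_nhdsWithin.mono fun y hy => (hmem y hy).1
  refine tendsto_nhdsWithin_iff.2 ⟨isCompact_prism.tendsto_nhds_of_unique_mapClusterPt hev
    fun z' hz' hcl => ?_, hev⟩
  refine h.injOn hD hK hz' hz ?_
  have h1 : MapClusterPt (Θ z') (𝓝[Θ '' D.prism n K] (Θ z)) (Θ ∘ D.Θinv n) :=
    hcl.tendsto_comp h.contDiff_Θ.continuous.continuousAt
  have h2 : Tendsto (Θ ∘ D.Θinv n) (𝓝[Θ '' D.prism n K] (Θ z)) (𝓝 (Θ z)) :=
    (tendsto_id.mono_left nhdsWithin_le_nhds).congr'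
      (eventually_mem_nhdsWithin.mono fun y hy => (hmem y hy).2.symm)
  have h3 : ClusterPt (Θ z') (𝓝 (Θ z)) := ClusterPt.mono h1 h2
  by_contra hne
  exact h3.ne (disjoint_nhds_nhds.2 hne).eq_bot

/-- Chain rule with the derivative of the inverse. The deformed prism inherits unique
differentiability from the prism through the surjective derivative of `Θ`, so the derivative within
it is determined even at its boundary. -/
lemma derivOn_eq (h : D.IsExtension n K φ Θ) (hD : D.IsRegular n) (hK : K ∈ D.cutElements n)
    {z : ST} (hz : z ∈ D.prism n K) : D.derivOn n K (Θ z) = tangentForm φ Θ z := by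
  obtain ⟨L, hL⟩ := h.isInvertible z hz
  have hinv : D.Θinv n (Θ z) = z := by rw [← h.Θ_eq z hz, Θinv_Θ hD hK hz]
  have hΘ : HasFDerivAt Θ (L : ST →L[ℝ] ST) z := by
    rw [hL]
    exact (h.hasStrictFDerivAt_Θ z).hasFDerivAt
  have hd : HasFDerivWithinAt (D.Θinv n) (L.symm : ST →L[ℝ] ST) (Θ '' D.prism n K) (Θ z) := by
    refine HasFDerivWithinAt.of_local_left_inverse (f := Θ) (t := D.prism n K) ?_ ?_
      (mem_image_of_mem Θ hz) ?_
    · rw [hinv]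
      exact h.tendsto_Θinv hD hK hz
    · rw [hinv]
      exact hΘ.hasFDerivWithinAt
    · refine eventually_mem_nhdsWithin.mono ?_
      rintro _ ⟨z', hz', rfl⟩
      rw [← h.Θ_eq z' hz', Θinv_Θ hD hK hz', h.Θ_eq z' hz']
  have hφ : HasFDerivAt φ (fderiv ℝ φ z) (D.Θinv n (Θ z)) := by
    rw [hinv]
    exact (h.hasStrictFDerivAt_φ z).hasFDerivAt
  have hcomp : HasFDerivWithinAt (fun y => φ (D.Θinv n y))
      (fderiv ℝ φ z ∘L (L.symm : ST →L[ℝ] ST)) (Θ '' D.prism n K) (Θ z) :=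
    hφ.comp_hasFDerivWithinAt (Θ z) hd
  have heq : ∀ y ∈ Θ '' D.prism n K,
      D.φhat n (D.Θinv n y).fst (D.Θinv n y).snd = φ (D.Θinv n y) := by
    rintro _ ⟨z', hz', rfl⟩
    rw [← h.Θ_eq z' hz', Θinv_Θ hD hK hz', h.φ_eq z' hz']
  have hu : UniqueDiffWithinAt ℝ (Θ '' D.prism n K) (Θ z) :=
    hΘ.hasFDerivWithinAt.uniqueDiffWithinAt (uniqueDiffOn_prism hK.1 z hz)
      L.surjective.denseRange
  rw [derivOn, h.image_eq, tangentForm, ← hL, ContinuousLinearMap.inverse_equiv]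
  exact (hcomp.congr heq (heq _ (mem_image_of_mem Θ hz))).fderivWithin hu

lemma VhOn_eq (h : D.IsExtension n K φ Θ) (hD : D.IsRegular n) (hK : K ∈ D.cutElements n)
    {z : ST} (hz : z ∈ D.prism n K) : D.VhOn n K (Θ z) = velocity (tangentForm φ Θ z) := by
  rw [VhOn, h.derivOn_eq hD hK hz, velocity]

lemma continuousAt_velocity (h : D.IsExtension n K φ Θ) {z : ST} (hz : z ∈ D.prism n K)
    (h0 : φ z = 0) : ContinuousAt (fun z => velocity (tangentForm φ Θ z)) z := by
  have h1 : ContinuousAt (fun z => (fderiv ℝ Θ z).inverse) z :=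
    ContinuousAt.comp (g := ContinuousLinearMap.inverse)
      ((h.isInvertible z hz).contDiffAt_map_inverse (n := 0)).continuousAt
      (h.contDiff_Θ.continuous_fderiv one_ne_zero).continuousAt
  have h2 : ContinuousAt (tangentForm φ Θ) z :=
    (h.contDiff_φ.continuous_fderiv one_ne_zero).continuousAt.clm_comp h1
  refine ContinuousAt.div ?_ ?_ ?_
  · exact (h2.clm_apply continuousAt_const).neg
  · exact (h2.clm_comp continuousAt_const).norm
  · exact norm_ne_zero_iff.2 (h.grad_ne_zero z hz h0)

lemma isCompact_zeroSet (h : D.IsExtension n K φ Θ) : IsCompact (D.zeroSet n K φ) :=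
  isCompact_prism.inter_right (isClosed_singleton.preimage h.contDiff_φ.continuous)

/-- The deformed zero set is locally an almost isometric chart on which the velocity is almost
constant. -/
lemma exists_chart (h : D.IsExtension n K φ Θ) (hD : D.IsRegular n) (hK : K ∈ D.cutElements n)
    {k : ℝ≥0} (hk : 1 < k) {z₀ : ST} (hz₀ : z₀ ∈ D.zeroSet n K φ) :
    ∃ U, IsOpen U ∧ z₀ ∈ U ∧ ∃ J π, IsChart k (Θ '' (D.zeroSet n K φ ∩ U)) J π ∧
      ∀ y ∈ Θ '' (D.zeroSet n K φ ∩ U),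
        ENNReal.ofReal (1 / Real.sqrt (1 + D.VhOn n K y ^ 2)) ≤ k * (J : ℝ≥0∞)⁻¹ ∧
        (J : ℝ≥0∞)⁻¹ ≤ k * ENNReal.ofReal (1 / Real.sqrt (1 + D.VhOn n K y ^ 2)) := by
  obtain ⟨ε, hε, π, hπ⟩ := exists_isChart (h.grad_ne_zero z₀ hz₀.1 hz₀.2) hk
  obtain ⟨L, hL⟩ := h.isInvertible z₀ hz₀.1
  have hΘ : HasStrictFDerivAt Θ (L : ST →L[ℝ] ST) z₀ := by
    rw [hL]
    exact h.hasStrictFDerivAt_Θ z₀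
  obtain ⟨U₁, hU₁, hflat⟩ := exists_nhds_almost_flat hΘ (h.hasStrictFDerivAt_φ z₀) hε
  set r : ST → ℝ := fun z => Real.sqrt (1 + velocity (tangentForm φ Θ z) ^ 2) with hr
  have hr0 : ∀ z, 0 < r z := fun z => Real.sqrt_pos.2 (by positivity)
  have hrc : ContinuousAt r z₀ :=
    (continuousAt_const.add ((h.continuousAt_velocity hz₀.1 hz₀.2).pow 2)).sqrt
  have hk' : (1 : ℝ) < k := by exact_mod_cast hk
  -- The chart scales time by the value `r z₀` at the centre; near `z₀` this differs from `r z` by a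
  -- factor less than `k`.
  have hev : ∀ᶠ z in 𝓝 z₀, r z < k * r z₀ ∧ r z₀ < k * r z :=
    (hrc.eventually_lt continuousAt_const (lt_mul_of_one_lt_left (hr0 z₀) hk')).and
      (continuousAt_const.eventually_lt (continuousAt_const.mul hrc)
        (lt_mul_of_one_lt_left (hr0 z₀) hk'))
  obtain ⟨U, hU, hUo, hzU⟩ := mem_nhds_iff.1 (inter_mem hU₁ hev)
  refine ⟨U, hUo, hzU, (r z₀).toNNReal, π, hπ _ ?_, ?_⟩
  · rintro _ ⟨z₁, ⟨h₁, hz₁⟩, rfl⟩ _ ⟨z₂, ⟨h₂, hz₂⟩, rfl⟩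
    rw [tangentForm, ← hL, ContinuousLinearMap.inverse_equiv]
    exact hflat z₁ (hU hz₁).1 z₂ (hU hz₂).1 (h₁.2.trans h₂.2.symm)
  · rintro _ ⟨z, ⟨hz, hzU⟩, rfl⟩
    rw [h.VhOn_eq hD hK hz.1]
    change ENNReal.ofReal (1 / r z) ≤ k * (ENNReal.ofReal (r z₀))⁻¹ ∧
      (ENNReal.ofReal (r z₀))⁻¹ ≤ k * ENNReal.ofReal (1 / r z)
    obtain ⟨h1, h2⟩ := (hU hzU).2
    rw [← ENNReal.ofReal_inv_of_pos (hr0 z₀), ← ENNReal.ofReal_coe_nnreal,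
      ← ENNReal.ofReal_mul k.coe_nonneg, ← ENNReal.ofReal_mul k.coe_nonneg]
    constructor <;> refine ENNReal.ofReal_le_ofReal ?_
    · rw [← div_eq_mul_inv, div_le_div_iff₀ (hr0 z) (hr0 z₀)]
      linarith
    · rw [mul_one_div, inv_eq_one_div, div_le_div_iff₀ (hr0 z₀) (hr0 z)]
      linarith

lemma measurableSet_image (h : D.IsExtension n K φ Θ) (hD : D.IsRegular n)
    (hK : K ∈ D.cutElements n) {B : Set ST} (hB : MeasurableSet B) (hBK : B ⊆ D.prism n K) :
    MeasurableSet (Θ '' B) :=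
  hB.image_of_continuousOn_injOn h.contDiff_Θ.continuous.continuousOn
    ((h.injOn hD hK).mono hBK)

/-- Charts exist around every point, and the Lindelöf property leaves countably many. -/
lemma sliceFormula (h : D.IsExtension n K φ Θ) (hD : D.IsRegular n) (hK : K ∈ D.cutElements n) :
    SliceFormula (Θ '' D.zeroSet n K φ)
      fun y => ENNReal.ofReal (1 / Real.sqrt (1 + D.VhOn n K y ^ 2)) := by
  refine sliceFormula_of_charts fun k hk => ?_
  choose! U hUo hzU J π hch using fun z₀ (hz₀ : z₀ ∈ D.zeroSet n K φ) =>
    h.exists_chart hD hK hk hz₀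
  obtain ⟨t, ht, htc, hcov⟩ := TopologicalSpace.countable_cover_nhdsWithin (f := U)
    (s := D.zeroSet n K φ) fun z hz => mem_nhdsWithin_of_mem_nhds ((hUo z hz).mem_nhds (hzU z hz))
  refine ⟨t, htc.to_subtype, fun z => Θ '' (D.zeroSet n K φ ∩ U z), fun z => ?_, ?_, fun z =>
    ⟨J z, π z, hch z (ht z.2)⟩⟩
  · exact h.measurableSet_image hD hK (h.isCompact_zeroSet.measurableSet.inter
      (hUo z (ht z.2)).measurableSet) (inter_subset_left.trans inter_subset_left)
  · rintro _ ⟨z, hz, rfl⟩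
    obtain ⟨z', hz't, hz'⟩ := mem_iUnion₂.1 (hcov hz)
    exact mem_iUnion.2 ⟨⟨z', hz't⟩, z, ⟨hz, hz'⟩, rfl⟩

/-- Compactness reduces this to one chart, whose image is a bounded subset of flat space. The
induction runs over arbitrary sets, intersected with the zero set. -/
lemma measure_lt_top (h : D.IsExtension n K φ Θ) (hD : D.IsRegular n) (hK : K ∈ D.cutElements n) :
    (μHE[3] : Measure ST) (Θ '' D.zeroSet n K φ) < ∞ := by
  have hb : Bornology.IsBounded (Θ '' D.zeroSet n K φ) :=
    (h.isCompact_zeroSet.image h.contDiff_Θ.continuous).isBounded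
  have key : (μHE[3] : Measure ST) (Θ '' (D.zeroSet n K φ ∩ D.zeroSet n K φ)) < ∞ := by
    refine h.isCompact_zeroSet.induction_on
      (p := fun s => (μHE[3] : Measure ST) (Θ '' (D.zeroSet n K φ ∩ s)) < ∞) (by simp)
      (fun s t hst ht => ?_) (fun s t hs ht => ?_) fun z hz => ?_
    · exact (measure_mono (image_mono (inter_subset_inter_right _ hst))).trans_lt ht
    · rw [inter_union_distrib_left, image_union]
      exact measure_union_lt_top hs ht
    · obtain ⟨U, hUo, hzU, J, π, hch, -⟩ := h.exists_chart hD hK one_lt_two hz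
      exact ⟨U, mem_nhdsWithin_of_mem_nhds (hUo.mem_nhds hzU),
        hch.measure_lt_top (hb.subset (image_mono inter_subset_left))⟩
  rwa [inter_self] at key

lemma aemeasurable_VhOn (h : D.IsExtension n K φ Θ) (hD : D.IsRegular n)
    (hK : K ∈ D.cutElements n) :
    AEMeasurable (D.VhOn n K) ((μHE[3] : Measure ST).restrict (Θ '' D.zeroSet n K φ)) := by
  have hc : ContinuousOn (D.VhOn n K) (Θ '' D.zeroSet n K φ) := by
    rintro _ ⟨z, hz, rfl⟩
    have heq : ∀ y ∈ Θ '' D.zeroSet n K φ,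
        D.VhOn n K y = velocity (tangentForm φ Θ (D.Θinv n y)) := by
      rintro _ ⟨z', hz', rfl⟩
      rw [h.VhOn_eq hD hK hz'.1, ← h.Θ_eq z' hz'.1, Θinv_Θ hD hK hz'.1]
    refine ContinuousWithinAt.congr ?_ heq (heq _ (mem_image_of_mem Θ hz))
    have h1 : Tendsto (D.Θinv n) (𝓝[Θ '' D.zeroSet n K φ] (Θ z)) (𝓝 z) :=
      ((h.tendsto_Θinv hD hK hz.1).mono_left
        (nhdsWithin_mono _ (image_mono inter_subset_left))).mono_right nhdsWithin_le_nhds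
    have h2 := (h.continuousAt_velocity hz.1 hz.2).tendsto.comp h1
    have h3 : D.Θinv n (Θ z) = z := by rw [← h.Θ_eq z hz.1, Θinv_Θ hD hK hz.1]
    rw [ContinuousWithinAt, h3]
    exact h2
  exact hc.aemeasurable (h.isCompact_zeroSet.image h.contDiff_Θ.continuous).measurableSet

end IsExtension

end Discretization

/-! ### Gluing the deformed prisms -/

namespace Discretization

variable {D : Discretization} {n : Fin D.N} {K : Finset E3}

variable (D n) in
/-- The part of the discrete surface in the deformed prism of `K`. -/
def ShOn (K : Finset E3) : Set ST := D.Q n ∩ D.Θ n '' (D.Slin n ∩ D.prism n K)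

lemma finite_cutElements : (D.cutElements n).Finite :=
  D.isTriangulation.finite_faces.subset fun _ hK => hK.1.1

lemma Sh_eq_iUnion : D.Sh n = ⋃ K : D.cutElements n, D.ShOn n K := by
  ext y
  simp only [Sh, QS, ShOn, mem_iUnion, mem_inter_iff, mem_image, mem_ofPred_eq]
  constructor
  · rintro ⟨hy, z, ⟨hz, K, hK, hzK⟩, rfl⟩
    exact ⟨⟨K, hK⟩, hy, z, ⟨hz, hzK⟩, rfl⟩
  · rintro ⟨⟨K, hK⟩, hy, z, ⟨hz, hzK⟩, rfl⟩
    exact ⟨hy, z, ⟨hz, K, hK, hzK⟩, rfl⟩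

lemma measurableSet_Q : MeasurableSet (D.Q n) := by
  have h : D.Q n = WithLp.ofLp ⁻¹' (D.Ω ×ˢ D.I n) := rfl
  rw [h]
  exact (WithLp.prod_continuous_ofLp 2 E3 ℝ).measurable
    (D.isOpen_Ω.measurableSet.prod measurableSet_Icc)

lemma Slin_inter_prism {φ : ST → ℝ} {Θ : ST → ST} (h : D.IsExtension n K φ Θ) :
    D.Slin n ∩ D.prism n K = D.Q n ∩ D.zeroSet n K φ := by
  ext z
  constructor
  · rintro ⟨⟨hQ, h0⟩, hz⟩
    exact ⟨hQ, hz, (h.φ_eq z hz).symm.trans h0⟩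
  · rintro ⟨hQ, hz, h0⟩
    exact ⟨⟨hQ, (h.φ_eq z hz).trans h0⟩, hz⟩

lemma ShOn_subset {φ : ST → ℝ} {Θ : ST → ST} (h : D.IsExtension n K φ Θ) :
    D.ShOn n K ⊆ Θ '' D.zeroSet n K φ := by
  rintro _ ⟨-, z, hz, rfl⟩
  rw [h.Θ_eq z hz.2]
  rw [Slin_inter_prism h] at hz
  exact mem_image_of_mem Θ hz.2

lemma measurableSet_ShOn (hD : D.IsRegular n) (hK : K ∈ D.cutElements n) :
    MeasurableSet (D.ShOn n K) := by
  obtain ⟨φ, Θ, h⟩ := exists_isExtension hD hK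
  have h1 : D.Θ n '' (D.Slin n ∩ D.prism n K) = Θ '' (D.Slin n ∩ D.prism n K) :=
    image_congr fun z hz => h.Θ_eq z hz.2
  rw [ShOn, h1]
  refine measurableSet_Q.inter (h.measurableSet_image hD hK ?_ inter_subset_right)
  rw [Slin_inter_prism h]
  exact measurableSet_Q.inter h.isCompact_zeroSet.measurableSet

lemma measure_ShOn_lt_top (hD : D.IsRegular n) (hK : K ∈ D.cutElements n) :
    (μHE[3] : Measure ST) (D.ShOn n K) < ∞ := by
  obtain ⟨φ, Θ, h⟩ := exists_isExtension hD hK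
  exact (measure_mono (ShOn_subset h)).trans_lt (h.measure_lt_top hD hK)

lemma sliceFormula_ShOn (hD : D.IsRegular n) (hK : K ∈ D.cutElements n) :
    SliceFormula (D.ShOn n K)
      fun y => ENNReal.ofReal (1 / Real.sqrt (1 + D.VhOn n K y ^ 2)) := by
  obtain ⟨φ, Θ, h⟩ := exists_isExtension hD hK
  exact (h.sliceFormula hD hK).mono (ShOn_subset h)

lemma aemeasurable_density_ShOn (hD : D.IsRegular n) (hK : K ∈ D.cutElements n) :
    AEMeasurable (fun y => 1 / Real.sqrt (1 + D.VhOn n K y ^ 2))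
      ((μHE[3] : Measure ST).restrict (D.ShOn n K)) := by
  obtain ⟨φ, Θ, h⟩ := exists_isExtension hD hK
  exact ((((h.aemeasurable_VhOn hD hK).mono_measure
    (Measure.restrict_mono (ShOn_subset h) le_rfl)).pow_const 2).const_add 1).sqrt.const_div 1

/-- Up to sign, the normal velocity does not depend on the choice of the deformed prism. -/
lemma ae_density_eq (hD : D.IsRegular n) (hK : K ∈ D.cutElements n) :
    ∀ᵐ y ∂(μHE[3] : Measure ST).restrict (D.ShOn n K),
      1 / Real.sqrt (1 + D.Vh n y ^ 2) = 1 / Real.sqrt (1 + D.VhOn n K y ^ 2) := by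
  -- There are finitely many cut elements, so one null set serves for all of them.
  have hpair : ∀ᵐ y ∂(μHE[3] : Measure ST).restrict (D.ShOn n K), ∀ K' ∈ D.cutElements n,
      y ∈ D.ShOn n K' →
        1 / Real.sqrt (1 + D.VhOn n K' y ^ 2) = 1 / Real.sqrt (1 + D.VhOn n K y ^ 2) := by
    rw [ae_ball_iff finite_cutElements.countable]
    intro K' hK'
    have h1 := (sliceFormula_ShOn hD hK').ae_eq (sliceFormula_ShOn hD hK)
      (measurableSet_ShOn hD hK') (measurableSet_ShOn hD hK) (measure_ShOn_lt_top hD hK').ne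
      (aemeasurable_density_ShOn hD hK').ennreal_ofReal
      (aemeasurable_density_ShOn hD hK).ennreal_ofReal
    rw [← Measure.restrict_restrict (measurableSet_ShOn hD hK')] at h1
    refine ((ae_restrict_iff' (measurableSet_ShOn hD hK')).1 h1).mono fun y hy hyK' => ?_
    exact (ENNReal.ofReal_eq_ofReal_iff (by positivity) (by positivity)).1 (hy hyK')
  filter_upwards [hpair, ae_restrict_mem (measurableSet_ShOn hD hK)] with y hy hyK
  obtain ⟨hyQ, z, ⟨hzS, hzK⟩, hzy⟩ := hyK
  have hex : ∃ K' ∈ D.cutElements n, y ∈ D.Θ n '' D.prism n K' := ⟨K, hK, z, hzK, hzy⟩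
  rw [Vh, dif_pos hex]
  obtain ⟨hK', z', hz', hzy'⟩ := hex.choose_spec
  refine hy _ hK' ⟨hyQ, z, ⟨hzS, ?_⟩, hzy⟩
  -- Injectivity on the union of the cut prisms: the point found in the chosen prism is the zero
  -- `z`, so `y` lies on the surface part belonging to that prism.
  have : z' = z := hD.injOn (prism_subset_QS hK' hz') (prism_subset_QS hK hzK)
    (hzy'.trans hzy.symm)
  rwa [← this]

lemma measurableSet_Sh (hD : D.IsRegular n) : MeasurableSet (D.Sh n) := by
  have := finite_cutElements (D := D) (n := n) |>.countable.to_subtype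
  rw [Sh_eq_iUnion]
  exact MeasurableSet.iUnion fun K => measurableSet_ShOn hD K.2

lemma measure_Sh_lt_top (hD : D.IsRegular n) : (μHE[3] : Measure ST) (D.Sh n) < ∞ := by
  rw [Sh_eq_iUnion, iUnion_subtype]
  exact measure_biUnion_lt_top finite_cutElements fun K hK => measure_ShOn_lt_top hD hK

lemma sliceFormula_Sh (hD : D.IsRegular n) :
    SliceFormula (D.Sh n) fun y => ENNReal.ofReal (1 / Real.sqrt (1 + D.Vh n y ^ 2)) := by
  have := finite_cutElements (D := D) (n := n) |>.countable.to_subtype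
  rw [Sh_eq_iUnion]
  exact SliceFormula.iUnion (fun K : D.cutElements n => measurableSet_ShOn hD K.2)
    (fun K => sliceFormula_ShOn hD K.2)
    fun K => (ae_density_eq hD K.2).mono fun y hy => congrArg ENNReal.ofReal hy

lemma aemeasurable_density_Sh (hD : D.IsRegular n) :
    AEMeasurable (fun y => 1 / Real.sqrt (1 + D.Vh n y ^ 2))
      ((μHE[3] : Measure ST).restrict (D.Sh n)) := by
  have := finite_cutElements (D := D) (n := n) |>.countable.to_subtype
  rw [Sh_eq_iUnion, aemeasurable_iUnion_iff]
  exact fun K => (aemeasurable_density_ShOn hD K.2).congr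
    ((ae_density_eq hD K.2).mono fun y hy => hy.symm)

end Discretization

end SpaceTimeSurface

end

theorem corollary4p5 (D : SpaceTimeSurface.Discretization) (n : Fin D.N) (hD : D.IsRegular n)
    (g : SpaceTimeSurface.ST → ℝ)
    (hg : MemLp g 2 ((μHE[3] : Measure SpaceTimeSurface.ST).restrict (D.Sh n))) :
    (∀ᵐ t ∂(volume.restrict (D.I n)),
        IntegrableOn (fun x => g (SpaceTimeSurface.pt x t)) (D.Γh n t)
          (μHE[2] : Measure SpaceTimeSurface.E3)) ∧
      IntegrableOn
        (fun t => ∫ x in D.Γh n t, g (SpaceTimeSurface.pt x t)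
          ∂(μHE[2] : Measure SpaceTimeSurface.E3))
        (D.I n) volume ∧
      IntegrableOn (fun y => g y / Real.sqrt (1 + D.Vh n y ^ 2)) (D.Sh n)
        (μHE[3] : Measure SpaceTimeSurface.ST) ∧
      ∫ t in (D.time n.castSucc)..(D.time n.succ),
          ∫ x in D.Γh n t, g (SpaceTimeSurface.pt x t)
            ∂(μHE[2] : Measure SpaceTimeSurface.E3) =
        ∫ y in D.Sh n, g y / Real.sqrt (1 + D.Vh n y ^ 2)
          ∂(μHE[3] : Measure SpaceTimeSurface.ST) := by
  -- Finite surface measure turns the `L²` hypothesis into integrability of `g`.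
  have : IsFiniteMeasure ((μHE[3] : Measure SpaceTimeSurface.ST).restrict (D.Sh n)) :=
    ⟨by
      rw [Measure.restrict_apply_univ]
      exact SpaceTimeSurface.Discretization.measure_Sh_lt_top hD⟩
  have h := (SpaceTimeSurface.Discretization.sliceFormula_Sh hD).integral
    (fun y => by positivity)
    (fun y => (div_le_one (by positivity)).2
      (Real.one_le_sqrt.2 (le_add_of_nonneg_right (sq_nonneg _))))
    (SpaceTimeSurface.Discretization.measurableSet_Sh hD)
    (SpaceTimeSurface.Discretization.aemeasurable_density_Sh hD) (D.time_lt n).le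
    (fun y hy => hy.1.2) (hg.integrable one_le_two)
  simp only [one_div_mul_eq_div] at h
  exact h
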